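/- **Setting.** Let $A\in\mathbb R^{n\times n}$ be symmetric positive semidefinite, $b\in\mathbb R^n$, $\tau\ge 0$, $f(x)=\frac12x^TAx-b^Tx$ and $F(x)=f(x)+\tau\|x\|_1$, and assume that $F$ has a global minimizer on $\mathbb R^n$ (an *optimal solution*). Let $\|\cdot\|$ be the Euclidean (for matrices: spectral) norm, $\|\cdot\|_\infty$ the maximum norm, and $[v]_J$ the subvector of $v$ indexed by $J$ (of norm $0$ if $J=\emptyset$). For $x\in\mathbb R^n$ put $I_0(x)=\{i:x_i=0\}$, $I_0^c(x)=\{i:x_i\ne0\}$, $I_\pm(x)=\{i:\pm x_i>0\}$, and $$I_0^0(x)=\{i\in I_0(x): |\nabla_if(x)|\le\tau\},\quad I_0^+(x)=\{i\in I_0(x):\nabla_if(x)+\tau<0\},\quad I_0^-(x)=\{i\in I_0(x):\nabla_if(x)-\tau>0\}.$$ Let $c_i(x;\tau)=\tau$ on $I_+(x)\cup I_0^+(x)$, $-\tau$ on $I_-(x)\cup I_0^-(x)$, and $0$ on $I_0^0(x)$. Let $v(x)$ be the minimum-norm subgradient of $F$ at $x$, i.e. $v_i(x)=\nabla_if(x)+\tau\,\mathrm{sgn}(x_i)$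 if $x_i\neq0$ and $v_i(x)=\min(\nabla_if(x)+\tau,\max(0,\nabla_if(x)-\tau))$ if $x_i=0$. Let $v^P(x)$ agree with $v(x)$ on $I_0(x)$ and vanish elsewhere, and let $F^*_x=\min\{F(y):y_i=0\text{ for }i\in I_0(x)\}$. For an index set $J$ let $P_J$ be the map that sets the coordinates in $J$ to $0$. **Subroutine $\mathrm{TPCG1}(A,b,c,J_0,J_-,J_+,x^0,\epsilon)$.** Let $\Omega=\{x: x_j=0\ (j\in J_0),\ x_j\le0\ (j\in J_-),\ x_j\ge0\ (j\in J_+)\}$, $r^0=Ax^0-b+c$, $p^0=P_{J_0}r^0$, $d^0=-p^0$. For $k=0,1,\dots$: let $\alpha_k=\min\{\alpha_k^{cg},\alpha_k^{tc}\}$ with $\alpha^{cg}_k=\|p^k\|^2/((d^k)^TAd^k)$ (equal to $\infty$ if $p^k\ne0$ and $(d^k)^TAd^k=0$) and $\alpha_k^{tc}=\max\{\alpha:x^k+\alpha d^k\in\Omega\}\in[0,\infty]$; let $x^{k+1}=x^k+\alpha_kd^k$; if $\alpha_k^{cg}>\alpha_k$, return $x^{k+1}$; let $r^{k+1}=r^k+\alpha_kAd^k$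 and $p^{k+1}=P_{J_0}r^{k+1}$; if $\|p^{k+1}\|_\infty\le\epsilon$, return $x^{k+1}$; let $d^{k+1}=-p^{k+1}+\frac{\|p^{k+1}\|^2}{\|p^k\|^2}d^k$. **Subroutine $\mathrm{TPCG2}(A,b,c,J_0,J_-,J_+,x^0,\epsilon)$.** Start with $(J^0_0,J^0_-,J^0_+)=(J_0,J_-,J_+)$. For $k=0,1,\dots$: if $\|P_{J_0^k}(Ax^k-b+c)\|_\infty\le\epsilon$, return $x^k$; otherwise let $x^{k+1}=\mathrm{TPCG1}(A,b,c,J_0^k,J_-^k,J_+^k,x^k,\epsilon)$ and $(J_0^{k+1},J_-^{k+1},J_+^{k+1})=(I_0(x^{k+1}),I_-(x^{k+1}),I_+(x^{k+1}))$. **Method** (variant of generalized CG method 2). Input: $A,b,\tau$, $x^0\in\mathbb R^n$, $\eta_0>0$, $\rho>1$, $\epsilon\ge0$. Start with $\hat\eta=\eta_0$ and $\mathcal C=\emptyset$. For $k=0,1,\dots$: if $\|v(x^k)\|_\infty\le\epsilon$, return $y=x^k$ and stop. Otherwise perform iteration $k$: * if $\|[v(x^k)]_{I_0(x^k)}\|>\sqrt{\hat\eta}\,\|[v(x^k)]_{I_0^c(x^k)}\|$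 and some member of $\mathcal C$ is a subset of $I_0(x^k)$, set $\hat\eta\leftarrow\rho\hat\eta$, $\mathcal C\leftarrow\emptyset$, $x^{k+1}=x^k$; * if the same inequality holds and no member of $\mathcal C$ is a subset of $I_0(x^k)$, set $\mathcal C\leftarrow\mathcal C\cup\{I_0(x^k)\}$ and $x^{k+1}=x^k-\alpha_kv^P(x^k)$ with $\alpha_k=\|v^P(x^k)\|^2/(v^P(x^k)^TAv^P(x^k))$; * if the inequality fails, set $$x^{k+1}=\mathrm{TPCG2}\Bigl(A,b,c(x^k;\tau),\ I_0^0(x^k),\ I_-(x^k)\cup I_0^-(x^k),\ I_+(x^k)\cup I_0^+(x^k),\ x^k,\ \tfrac{\epsilon}{\max(\sqrt{n\hat\eta},1)}\Bigr).$$ **Theorem.** There is a smallest $\eta^*\ge0$ among all $\eta\ge0$ such that $$2\|A\|\,\bigl(F(x)-F^*_x\bigr)\le\eta\,\bigl\|[v(x)]_{I_0^c(x)}\bigr\|^2\quad\text{for all }x\text{ with }F(x)\le F(x^0),$$ and the following hold. (i) The method is well defined (every call of a subroutine terminates, and all divisions and step lengths are legitimate), and it terminates after at most $$N=\max\left(\left\lceil\frac{\log\eta^*-\log\eta_0}{\log\rho}\right\rceil+1,\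 1\right)(2^{n+1}-1)$$ iterations, where $\log 0=-\infty$, so that $N=2^{n+1}-1$ if $\eta^*=0$. (ii) Its output $y$ satisfies $s\in\partial F(y)$ for some $s$ with $\|s\|_\infty\le\epsilon$, and $y$ is an optimal solution if $\epsilon=0$. -/

import Mathlib

open scoped Matrix

noncomputable section

namespace L1QP

section Problem

variable {n : ℕ}

/-! Vectors of `ℝⁿ` are functions `Fin n → ℝ`. On this type Lean's `‖x‖` is the maximum norm
`‖x‖_∞`; squared Euclidean norms are written as `x ⬝ᵥ x`. -/

/-- The smooth part `f(x) = ½ xᵀ A x - bᵀ x`. -/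
def smoothPart (A : Matrix (Fin n) (Fin n) ℝ) (b x : Fin n → ℝ) : ℝ :=
  1 / 2 * (x ⬝ᵥ (A *ᵥ x)) - b ⬝ᵥ x

/-- The objective `F(x) = ½ xᵀ A x - bᵀ x + τ ‖x‖₁`. -/
def objective (A : Matrix (Fin n) (Fin n) ℝ) (b : Fin n → ℝ) (τ : ℝ) (x : Fin n → ℝ) : ℝ :=
  smoothPart A b x + τ * ∑ i, |x i|

/-- `y` is an optimal solution: a global minimizer of `F`. -/
def IsOptimal (A : Matrix (Fin n) (Fin n) ℝ) (b : Fin n → ℝ) (τ : ℝ) (y : Fin n → ℝ) : Prop :=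
  ∀ z, objective A b τ y ≤ objective A b τ z

/-- The subdifferential `∂F(y)` of convex analysis. -/
def subdifferential (F : (Fin n → ℝ) → ℝ) (y : Fin n → ℝ) : Set (Fin n → ℝ) :=
  {s | ∀ z, F y + s ⬝ᵥ (z - y) ≤ F z}

/-- The gradient `∇f(x) = A x - b` (for symmetric `A`). -/
def grad (A : Matrix (Fin n) (Fin n) ℝ) (b x : Fin n → ℝ) : Fin n → ℝ :=
  A *ᵥ x - b

/-- The minimum-norm subgradient `v(x)` of `F` at `x`, in its closed form. -/
def minSubgrad (A : Matrix (Fin n) (Fin n) ℝ) (b : Fin n → ℝ) (τ : ℝ) (x : Fin n → ℝ) :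
    Fin n → ℝ := fun i =>
  if x i ≠ 0 then grad A b x i + τ * Real.sign (x i)
  else min (grad A b x i + τ) (max 0 (grad A b x i - τ))

/-- `I₋(x)`. -/
def negSet (x : Fin n → ℝ) : Finset (Fin n) := {i | x i < 0}

/-- `I₊(x)`. -/
def posSet (x : Fin n → ℝ) : Finset (Fin n) := {i | 0 < x i}

/-- `I₀(x)`. -/
def zeroSet (x : Fin n → ℝ) : Finset (Fin n) := {i | x i = 0}

/-- `I₀ᶜ(x)`. -/
def nonzeroSet (x : Fin n → ℝ) : Finset (Fin n) := {i | x i ≠ 0}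

/-- `I₀⁰(x)`: the zero components with `0 ∈ [∇ᵢf(x) - τ, ∇ᵢf(x) + τ]`. -/
def zeroSetStay (A : Matrix (Fin n) (Fin n) ℝ) (b : Fin n → ℝ) (τ : ℝ) (x : Fin n → ℝ) :
    Finset (Fin n) :=
  {i | x i = 0 ∧ grad A b x i - τ ≤ 0 ∧ 0 ≤ grad A b x i + τ}

/-- `I₀⁺(x)`: the zero components with `∇ᵢf(x) + τ < 0`. -/
def zeroSetPos (A : Matrix (Fin n) (Fin n) ℝ) (b : Fin n → ℝ) (τ : ℝ) (x : Fin n → ℝ) :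
    Finset (Fin n) :=
  {i | x i = 0 ∧ grad A b x i + τ < 0}

/-- `I₀⁻(x)`: the zero components with `∇ᵢf(x) - τ > 0`. -/
def zeroSetNeg (A : Matrix (Fin n) (Fin n) ℝ) (b : Fin n → ℝ) (τ : ℝ) (x : Fin n → ℝ) :
    Finset (Fin n) :=
  {i | x i = 0 ∧ 0 < grad A b x i - τ}

/-- The sign vector `c(x; τ) ∈ {-τ, 0, τ}ⁿ`. -/
def signCost (A : Matrix (Fin n) (Fin n) ℝ) (b : Fin n → ℝ) (τ : ℝ) (x : Fin n → ℝ) :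
    Fin n → ℝ := fun i =>
  if i ∈ posSet x ∪ zeroSetPos A b τ x then τ
  else if i ∈ negSet x ∪ zeroSetNeg A b τ x then -τ
  else 0

/-- The projected minimum-norm subgradient `v^P(x)`. -/
def projSubgrad (A : Matrix (Fin n) (Fin n) ℝ) (b : Fin n → ℝ) (τ : ℝ) (x : Fin n → ℝ) :
    Fin n → ℝ := fun i =>
  if i ∈ zeroSet x then minSubgrad A b τ x i else 0

/-- The Euclidean norm `‖v_J‖` of the subvector of `v` indexed by `J`. -/
def normOn (J : Finset (Fin n)) (v : Fin n → ℝ) : ℝ :=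
  √(∑ i ∈ J, v i ^ 2)

/-- The spectral norm `‖A‖`. -/
def specNorm (A : Matrix (Fin n) (Fin n) ℝ) : ℝ :=
  ‖Matrix.toEuclideanCLM (n := Fin n) (𝕜 := ℝ) A‖

/-- `F*_x`, the minimum of `F` over `{y : yᵢ = 0 for i ∈ I₀(x)}`. -/
def faceMin (A : Matrix (Fin n) (Fin n) ℝ) (b : Fin n → ℝ) (τ : ℝ) (x : Fin n → ℝ) : ℝ :=
  sInf (objective A b τ '' {y | ∀ i ∈ zeroSet x, y i = 0})

/-- `η ≥ 0` satisfies `F(x) - F*_x ≤ η / (2‖A‖) * ‖v(x)_J‖²`, `J = I₀ᶜ(x)`, for all `x` with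
`F(x) ≤ F(x⁰)`. The inequality is multiplied by `2‖A‖`, so that `A = 0` is meaningful too. -/
def ErrorBound (A : Matrix (Fin n) (Fin n) ℝ) (b : Fin n → ℝ) (τ : ℝ) (x₀ : Fin n → ℝ)
    (η : ℝ) : Prop :=
  0 ≤ η ∧ ∀ x, objective A b τ x ≤ objective A b τ x₀ →
    2 * specNorm A * (objective A b τ x - faceMin A b τ x) ≤
      η * normOn (nonzeroSet x) (minSubgrad A b τ x) ^ 2

end Problem

/-! The algorithms are partial functions: a loop is `PFun.fix` of one pass through its body, which
either returns an output (`Sum.inl`) or the state for the next pass (`Sum.inr`). A run that never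
stops, or that meets a division by zero or an infinite step length, has no output. -/

section Algorithms

/-- Division, undefined when the denominator is zero. -/
def partDiv (a c : ℝ) : Part ℝ := if c = 0 then Part.none else Part.some (a / c)

/-- The real value of an extended real, undefined at `±∞`. -/
def finiteValue (a : EReal) : Part ℝ :=
  if a = ⊤ ∨ a = ⊥ then Part.none else Part.some a.toReal

variable {n : ℕ}

/-- The projection of `r` onto `{x : xⱼ = 0 for j ∈ J}`. -/
def zeroOn (J : Finset (Fin n)) (r : Fin n → ℝ) : Fin n → ℝ := fun i =>
  if i ∈ J then 0 else r i

/-- The feasible region `Ω`: `xⱼ = 0` on `J₀`, `xⱼ ≤ 0` on `J₋`, `xⱼ ≥ 0` on `J₊`. -/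
def face (J₀ Jm Jp : Finset (Fin n)) : Set (Fin n → ℝ) :=
  {x | (∀ j ∈ J₀, x j = 0) ∧ (∀ j ∈ Jm, x j ≤ 0) ∧ ∀ j ∈ Jp, 0 ≤ x j}

/-- The variables `x^k, r^k, p^k, d^k` of the first subroutine. -/
structure PCGState (n : ℕ) where
  x : Fin n → ℝ
  r : Fin n → ℝ
  p : Fin n → ℝ
  d : Fin n → ℝ

/-- The CG step length `‖p‖² / dᵀAd`, which is `∞` if `p ≠ 0` and `dᵀAd = 0`. -/
def cgLength (A : Matrix (Fin n) (Fin n) ℝ) (p d : Fin n → ℝ) : Part EReal :=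
  if p ≠ 0 ∧ d ⬝ᵥ (A *ᵥ d) = 0 then Part.some ⊤
  else (partDiv (p ⬝ᵥ p) (d ⬝ᵥ (A *ᵥ d))).map Real.toEReal

/-- The truncation length `max {α : x + α d ∈ Ω}`, which is `∞` if there is no largest `α`. -/
def truncLength (J₀ Jm Jp : Finset (Fin n)) (x d : Fin n → ℝ) : EReal :=
  sSup (Real.toEReal '' {α : ℝ | x + α • d ∈ face J₀ Jm Jp})

/-- One pass through the loop of the truncated projected CG subroutine 1. -/
def tpcg1Step (A : Matrix (Fin n) (Fin n) ℝ) (J₀ Jm Jp : Finset (Fin n)) (ε : ℝ)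
    (s : PCGState n) : Part ((Fin n → ℝ) ⊕ PCGState n) :=
  (cgLength A s.p s.d).bind fun αcg =>
  (finiteValue (min αcg (truncLength J₀ Jm Jp s.x s.d))).bind fun α =>
    let x' := s.x + α • s.d
    let r' := s.r + α • (A *ᵥ s.d)
    let p' := zeroOn J₀ r'
    if (α : EReal) < αcg then Part.some (Sum.inl x')
    else if ‖p'‖ ≤ ε then Part.some (Sum.inl x')
    else (partDiv (p' ⬝ᵥ p') (s.p ⬝ᵥ s.p)).bind fun β =>
      Part.some (Sum.inr ⟨x', r', p', -p' + β • s.d⟩)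

/-- Subroutine 1, `TPCG1(A, b, c, J₀, J₋, J₊, x⁰, ε)`. -/
def tpcg1 (A : Matrix (Fin n) (Fin n) ℝ) (b c : Fin n → ℝ) (J₀ Jm Jp : Finset (Fin n))
    (x₀ : Fin n → ℝ) (ε : ℝ) : Part (Fin n → ℝ) :=
  let r₀ := A *ᵥ x₀ - b + c
  let p₀ := zeroOn J₀ r₀
  PFun.fix (tpcg1Step A J₀ Jm Jp ε) ⟨x₀, r₀, p₀, -p₀⟩

/-- The variables `J₀^k, J₋^k, J₊^k, x^k` of the second subroutine. -/
structure FaceState (n : ℕ) where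
  J₀ : Finset (Fin n)
  Jm : Finset (Fin n)
  Jp : Finset (Fin n)
  x : Fin n → ℝ

/-- One pass through the loop of the truncated projected CG subroutine 2. -/
def tpcg2Step (A : Matrix (Fin n) (Fin n) ℝ) (b c : Fin n → ℝ) (ε : ℝ) (s : FaceState n) :
    Part ((Fin n → ℝ) ⊕ FaceState n) :=
  if ‖zeroOn s.J₀ (A *ᵥ s.x - b + c)‖ ≤ ε then Part.some (Sum.inl s.x)
  else (tpcg1 A b c s.J₀ s.Jm s.Jp s.x ε).map fun y =>
    Sum.inr ⟨zeroSet y, negSet y, posSet y, y⟩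

/-- Subroutine 2, `TPCG2(A, b, c, J₀, J₋, J₊, x⁰, ε)`. -/
def tpcg2 (A : Matrix (Fin n) (Fin n) ℝ) (b c : Fin n → ℝ) (J₀ Jm Jp : Finset (Fin n))
    (x₀ : Fin n → ℝ) (ε : ℝ) : Part (Fin n → ℝ) :=
  PFun.fix (tpcg2Step A b c ε) ⟨J₀, Jm, Jp, x₀⟩

/-- The variables of the main method: the iteration counter `k`, the current guess `η̂`, the
collection `𝒞` of index sets, and the iterate `x^k`. -/
structure MainState (n : ℕ) where
  k : ℕ
  η : ℝ
  C : Finset (Finset (Fin n))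
  x : Fin n → ℝ

/-- One iteration of the variant of generalized CG method 2. The output is the pair of the returned
point `y = x^k` and the number `k` of completed iterations. -/
def cg2vStep (A : Matrix (Fin n) (Fin n) ℝ) (b : Fin n → ℝ) (τ ρ ε : ℝ) (s : MainState n) :
    Part (((Fin n → ℝ) × ℕ) ⊕ MainState n) :=
  let v := minSubgrad A b τ s.x
  let vp := projSubgrad A b τ s.x
  if ‖v‖ ≤ ε then Part.some (Sum.inl (s.x, s.k))
  else if √s.η * normOn (nonzeroSet s.x) v < normOn (zeroSet s.x) v then
    if s.C ≠ ∅ ∧ ∃ I ∈ s.C, I ⊆ zeroSet s.x then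
      Part.some (Sum.inr ⟨s.k + 1, ρ * s.η, ∅, s.x⟩)
    else (partDiv (vp ⬝ᵥ vp) (vp ⬝ᵥ (A *ᵥ vp))).bind fun α =>
      Part.some (Sum.inr ⟨s.k + 1, s.η, insert (zeroSet s.x) s.C, s.x - α • vp⟩)
  else
    (tpcg2 A b (signCost A b τ s.x) (zeroSetStay A b τ s.x)
        (negSet s.x ∪ zeroSetNeg A b τ s.x) (posSet s.x ∪ zeroSetPos A b τ s.x) s.x
        (ε / max √(n * s.η) 1)).map fun y =>
      Sum.inr ⟨s.k + 1, s.η, s.C, y⟩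

/-- The variant of generalized CG method 2 with input `A, b, τ, x⁰, η₀, ρ, ε`. -/
def cg2v (A : Matrix (Fin n) (Fin n) ℝ) (b : Fin n → ℝ) (τ : ℝ) (x₀ : Fin n → ℝ)
    (η₀ ρ ε : ℝ) : Part ((Fin n → ℝ) × ℕ) :=
  PFun.fix (cg2vStep A b τ ρ ε) ⟨0, η₀, ∅, x₀⟩

/-- `max(⌈(log η* - log η₀) / log ρ⌉ + 1, 1)`, with the convention `log 0 = -∞`. -/
def guessBound (ηs η₀ ρ : ℝ) : ℤ :=
  if ηs = 0 then 1 else max (⌈(Real.log ηs - Real.log η₀) / Real.log ρ⌉ + 1) 1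

end Algorithms

end L1QP

end

/-! On a face of fixed signs the l1 term is linear, so `F` equals the quadratic `f + cᵀx` there and
dominates it elsewhere when every `|cᵢ| ≤ τ`. Three facts about this quadratic carry the proof.

Truncated CG is finite (`tpcg1_spec`, `tpcg2_spec`): nonzero projected residuals are mutually
orthogonal, so full steps number at most the dimension. A truncated step creates a new zero, which
the next call freezes. Steps are finite because `F` is bounded below.

The error bound holds (`exists_errorBound_of_sign`): on each sign pattern the gradient of the
quadratic either controls the gap to the minimum or stays away from zero. There are finitely many
patterns, and the set of valid constants is closed, so a least one exists.

A projected subgradient step with exact line search lowers `F` by at least `‖v^P‖²/(2‖A‖)` if `A ≠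
0`. If `I₀(x)` dominates and the guess is at least `η*`, this exceeds `F(x) - F*_x`. No later
iterate can then vanish on `I₀(x)`, since `F` never increases. A repeated or larger zero set thus
proves the guess too small, which bounds the number of increases.

For counting, each guess value allows at most `2^n - 2` recorded sets that are nonempty and proper;
the full set occurs only at `x = 0`, hence once in the whole run. A call of the second subroutine
ends where the method stops or the zero components dominate, so two calls are never consecutive. -/

namespace L1QP

/-- Termination of a loop with an invariant and a variant: `Inv m s` says that the state `s` is
reachable with at most `m` passes to go. -/
theorem exists_mem_fix {α β : Type*} {f : α →. β ⊕ α} {Inv : ℕ → α → Prop} {Q : β → Prop}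
    (h : ∀ m s, Inv m s → (∃ b, Sum.inl b ∈ f s ∧ Q b) ∨
      ∃ s' m', m' < m ∧ Sum.inr s' ∈ f s ∧ Inv m' s')
    {m : ℕ} {s : α} (hs : Inv m s) : ∃ b ∈ PFun.fix f s, Q b := by
  induction m using Nat.strong_induction_on generalizing s with
  | _ m ih =>
    rcases h m s hs with ⟨b, hb, hQ⟩ | ⟨s', m', hm, hs', hi⟩
    · exact ⟨b, PFun.mem_fix_iff.2 (Or.inl hb), hQ⟩
    · obtain ⟨b, hb, hQ⟩ := ih m' hm hi
      exact ⟨b, PFun.mem_fix_iff.2 (Or.inr ⟨s', hs', hb⟩), hQ⟩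

/-! ### The quadratic part and the minimum-norm subgradient -/

variable {n : ℕ} {A : Matrix (Fin n) (Fin n) ℝ} {b c x : Fin n → ℝ} {τ : ℝ}

theorem dotProduct_mulVec_symm (hA : A.PosSemidef) (x y : Fin n → ℝ) :
    x ⬝ᵥ (A *ᵥ y) = y ⬝ᵥ (A *ᵥ x) := by
  have h : Aᵀ = A := by simpa using hA.1.eq
  rw [Matrix.dotProduct_mulVec, ← Matrix.mulVec_transpose, h, dotProduct_comm]

theorem dotProduct_mulVec_self_nonneg (hA : A.PosSemidef) (x : Fin n → ℝ) :
    0 ≤ x ⬝ᵥ (A *ᵥ x) := by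
  simpa using hA.dotProduct_mulVec_nonneg x

theorem smoothPart_add_smul (hA : A.PosSemidef) (b x d : Fin n → ℝ) (α : ℝ) :
    smoothPart A b (x + α • d) =
      smoothPart A b x + α * (grad A b x ⬝ᵥ d) + α ^ 2 / 2 * (d ⬝ᵥ (A *ᵥ d)) := by
  have h1 := dotProduct_mulVec_symm hA x d
  have h2 : (A *ᵥ x) ⬝ᵥ d = d ⬝ᵥ (A *ᵥ x) := dotProduct_comm _ _
  simp only [smoothPart, grad, Matrix.mulVec_add, Matrix.mulVec_smul, dotProduct_add,
    add_dotProduct, sub_dotProduct, dotProduct_smul, smul_dotProduct, smul_eq_mul, h1, h2]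
  ring

theorem smoothPart_add (hA : A.PosSemidef) (b x d : Fin n → ℝ) :
    smoothPart A b (x + d) =
      smoothPart A b x + grad A b x ⬝ᵥ d + 1 / 2 * (d ⬝ᵥ (A *ᵥ d)) := by
  simpa using smoothPart_add_smul hA b x d 1

theorem smoothPart_ge (hA : A.PosSemidef) (b x y : Fin n → ℝ) :
    smoothPart A b x + grad A b x ⬝ᵥ (y - x) ≤ smoothPart A b y := by
  have h := smoothPart_add hA b x (y - x)
  rw [add_sub_cancel] at h
  have := dotProduct_mulVec_self_nonneg hA (y - x)
  linarith

theorem smoothPart_sub (A : Matrix (Fin n) (Fin n) ℝ) (b c x : Fin n → ℝ) :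
    smoothPart A (b - c) x = smoothPart A b x + c ⬝ᵥ x := by
  simp only [smoothPart, sub_dotProduct]; ring

theorem objective_eq_smoothPart (h : ∀ i, τ * |x i| = c i * x i) :
    objective A b τ x = smoothPart A (b - c) x := by
  rw [smoothPart_sub, objective, Finset.mul_sum, dotProduct]
  simp only [h]

theorem smoothPart_le_objective (h : ∀ i, c i * x i ≤ τ * |x i|) :
    smoothPart A (b - c) x ≤ objective A b τ x := by
  rw [smoothPart_sub, objective, Finset.mul_sum, dotProduct]
  exact add_le_add_right (Finset.sum_le_sum fun i _ => h i) _

theorem minSubgrad_of_pos {i : Fin n} (h : 0 < x i) :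
    minSubgrad A b τ x i = grad A b x i + τ := by
  simp [minSubgrad, h.ne', Real.sign_of_pos h]

theorem minSubgrad_of_neg {i : Fin n} (h : x i < 0) :
    minSubgrad A b τ x i = grad A b x i - τ := by
  simp [minSubgrad, h.ne, Real.sign_of_neg h]; ring

theorem minSubgrad_of_eq_zero {i : Fin n} (h : x i = 0) :
    minSubgrad A b τ x i = min (grad A b x i + τ) (max 0 (grad A b x i - τ)) := by
  simp [minSubgrad, h]

/-- Where `τ|xᵢ| = cᵢxᵢ` and `xᵢ ≠ 0`, the minimum-norm subgradient is the gradient of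
`f + cᵀx`. -/
theorem minSubgrad_of_ne_zero {i : Fin n} (h : x i ≠ 0) (hc : τ * |x i| = c i * x i) :
    minSubgrad A b τ x i = (A *ᵥ x - b + c) i := by
  rcases lt_or_gt_of_ne h with h | h
  · rw [minSubgrad_of_neg h]
    rw [abs_of_neg h] at hc
    have : c i = -τ := mul_right_cancel₀ h.ne (by linarith)
    simp [grad, this]; ring
  · rw [minSubgrad_of_pos h]
    rw [abs_of_pos h] at hc
    have : c i = τ := mul_right_cancel₀ h.ne' hc.symm
    simp [grad, this]

theorem minSubgrad_mem_subdifferential (hA : A.PosSemidef) (b : Fin n → ℝ) (hτ : 0 ≤ τ)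
    (y : Fin n → ℝ) : minSubgrad A b τ y ∈ subdifferential (objective A b τ) y := by
  intro z
  have h := smoothPart_ge hA b y z
  have key : minSubgrad A b τ y ⬝ᵥ (z - y) + τ * ∑ i, |y i| ≤
      grad A b y ⬝ᵥ (z - y) + τ * ∑ i, |z i| := by
    simp only [dotProduct, Finset.mul_sum, ← Finset.sum_add_distrib]
    refine Finset.sum_le_sum fun i _ => ?_
    simp only [Pi.sub_apply]
    have hz1 := mul_le_mul_of_nonneg_left (le_abs_self (z i)) hτ
    have hz2 := mul_le_mul_of_nonneg_left (neg_le_abs (z i)) hτ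
    rcases lt_trichotomy (y i) 0 with hy | hy | hy
    · rw [minSubgrad_of_neg hy, abs_of_neg hy]; linarith
    · rw [minSubgrad_of_eq_zero hy, hy]
      set g := grad A b y i
      have h1 : min (g + τ) (max 0 (g - τ)) ≤ g + τ := min_le_left _ _
      have h2 : g - τ ≤ min (g + τ) (max 0 (g - τ)) :=
        le_min (by linarith) (le_max_right _ _)
      -- The thresholded value differs from `g` by at most `τ`, which is the subgradient condition
      -- for `τ|·|` at zero.
      have h3 : (min (g + τ) (max 0 (g - τ)) - g) * z i ≤ τ * |z i| := by
        refine (le_abs_self _).trans ?_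
        rw [abs_mul]
        exact mul_le_mul_of_nonneg_right (abs_le.2 ⟨by linarith, by linarith⟩) (abs_nonneg _)
      simp only [abs_zero, sub_zero, mul_zero]
      linarith
    · rw [minSubgrad_of_pos hy, abs_of_pos hy]; linarith
  simp only [objective]
  linarith

theorem isOptimal_of_minSubgrad_eq_zero (hA : A.PosSemidef) (hτ : 0 ≤ τ) {y : Fin n → ℝ}
    (h : minSubgrad A b τ y = 0) : IsOptimal A b τ y := by
  intro z
  have := minSubgrad_mem_subdifferential hA b hτ y z
  simpa [h] using this

/-! ### The truncation length -/

variable {J₀ Jm Jp : Finset (Fin n)} {d : Fin n → ℝ}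

theorem truncLength_nonneg (hx : x ∈ face J₀ Jm Jp) : 0 ≤ truncLength J₀ Jm Jp x d :=
  le_sSup ⟨0, by simpa using hx, rfl⟩

/-- Each sign constraint that can become active bounds every feasible step length by a ratio, so it
also bounds their supremum. Attainment of the supremum is never needed. -/
theorem add_smul_mem_face (hx : x ∈ face J₀ Jm Jp) (hd : ∀ j ∈ J₀, d j = 0) {α : ℝ}
    (hα : 0 ≤ α) (h : (α : EReal) ≤ truncLength J₀ Jm Jp x d) : x + α • d ∈ face J₀ Jm Jp := by
  have key : ∀ t : ℝ, (∀ β : ℝ, x + β • d ∈ face J₀ Jm Jp → β ≤ t) → α ≤ t := by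
    intro t ht
    refine EReal.coe_le_coe_iff.1 (h.trans (sSup_le ?_))
    rintro _ ⟨β, hβ, rfl⟩
    exact EReal.coe_le_coe_iff.2 (ht β hβ)
  refine ⟨fun j hj => by simp [hx.1 j hj, hd j hj], fun j hj => ?_, fun j hj => ?_⟩
  · have hxj := hx.2.1 j hj
    simp only [Pi.add_apply, Pi.smul_apply, smul_eq_mul]
    rcases le_or_gt (d j) 0 with hdj | hdj
    · nlinarith
    · have := key (-x j / d j) fun β hβ => by
        have := hβ.2.1 j hj
        simp only [Pi.add_apply, Pi.smul_apply, smul_eq_mul] at this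
        rw [le_div_iff₀ hdj]; linarith
      rw [le_div_iff₀ hdj] at this; linarith
  · have hxj := hx.2.2 j hj
    simp only [Pi.add_apply, Pi.smul_apply, smul_eq_mul]
    rcases le_or_gt 0 (d j) with hdj | hdj
    · nlinarith
    · have := key (x j / -d j) fun β hβ => by
        have := hβ.2.2 j hj
        simp only [Pi.add_apply, Pi.smul_apply, smul_eq_mul] at this
        rw [le_div_iff₀ (by linarith)]; linarith
      rw [le_div_iff₀ (by linarith)] at this; linarith

/-- If no coordinate outside `J₀` vanished, all sign constraints there would be strict, and a
slightly longer step would remain feasible. -/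
theorem exists_eq_zero_of_truncLength_eq (hx : x ∈ face J₀ Jm Jp) (hd : ∀ j ∈ J₀, d j = 0)
    {α : ℝ} (hα : 0 ≤ α) (h : truncLength J₀ Jm Jp x d = α) :
    ∃ j ∉ J₀, (x + α • d) j = 0 := by
  by_contra! hne
  have hmem := add_smul_mem_face hx hd hα h.ge
  have hcont : ∀ j, Filter.Tendsto (fun β : ℝ => (x + β • d) j) (nhds α)
      (nhds ((x + α • d) j)) := fun j => by
    have : Continuous fun β : ℝ => (x + β • d) j := by
      simp only [Pi.add_apply, Pi.smul_apply]; fun_prop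
    exact this.tendsto α
  have hev : ∀ᶠ β in nhds α, x + β • d ∈ face J₀ Jm Jp := by
    have hm : ∀ᶠ β in nhds α, ∀ j ∈ Jm, (x + β • d) j ≤ 0 := by
      refine (Filter.eventually_all_finset Jm).2 fun j hj => ?_
      by_cases hj0 : j ∈ J₀
      · exact Filter.Eventually.of_forall fun β => by simp [hx.1 j hj0, hd j hj0]
      · exact ((hcont j).eventually_lt_const
          (lt_of_le_of_ne (hmem.2.1 j hj) (hne j hj0))).mono fun _ => le_of_lt
    have hp : ∀ᶠ β in nhds α, ∀ j ∈ Jp, 0 ≤ (x + β • d) j := by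
      refine (Filter.eventually_all_finset Jp).2 fun j hj => ?_
      by_cases hj0 : j ∈ J₀
      · exact Filter.Eventually.of_forall fun β => by simp [hx.1 j hj0, hd j hj0]
      · exact ((hcont j).eventually_const_lt
          (lt_of_le_of_ne (hmem.2.2 j hj) (hne j hj0).symm)).mono fun _ => le_of_lt
    filter_upwards [hm, hp] with β h1 h2
    exact ⟨fun j hj => by simp [hx.1 j hj, hd j hj], h1, h2⟩
  obtain ⟨β, hβ, hlt⟩ := ((hev.filter_mono nhdsWithin_le_nhds).and
    (self_mem_nhdsWithin : Set.Ioi α ∈ nhdsWithin α (Set.Ioi α))).exists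
  have h1 : (β : EReal) ≤ truncLength J₀ Jm Jp x d := le_sSup ⟨β, hβ, rfl⟩
  rw [h, EReal.coe_le_coe_iff] at h1
  exact absurd hlt (not_lt.2 h1)

theorem dotProduct_zeroOn (r : Fin n → ℝ) {w : Fin n → ℝ} (hw : ∀ j ∈ J₀, w j = 0) :
    w ⬝ᵥ zeroOn J₀ r = w ⬝ᵥ r := by
  refine Finset.sum_congr rfl fun i _ => ?_
  by_cases hi : i ∈ J₀ <;> simp [zeroOn, hi, hw]

theorem zeroOn_add_smul (J : Finset (Fin n)) (r w : Fin n → ℝ) (α : ℝ) :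
    zeroOn J (r + α • w) = zeroOn J r + α • zeroOn J w := by
  ext i
  by_cases hi : i ∈ J <;> simp [zeroOn, hi]

theorem norm_zeroOn_anti {J J' : Finset (Fin n)} (h : J ⊆ J') (r : Fin n → ℝ) :
    ‖zeroOn J' r‖ ≤ ‖zeroOn J r‖ := by
  refine (pi_norm_le_iff_of_nonneg (norm_nonneg _)).2 fun i => ?_
  refine le_trans ?_ (norm_le_pi_norm _ i)
  by_cases hi : i ∈ J'
  · simp [zeroOn, hi]
  · have hi' : i ∉ J := fun h' => hi (h h')
    simp [zeroOn, hi, hi']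

end L1QP

/-! ### Truncated projected conjugate gradients -/

namespace L1QP

variable {n : ℕ} {A : Matrix (Fin n) (Fin n) ℝ} {b c x x₀ : Fin n → ℝ} {τ ε : ℝ}
  {J₀ Jm Jp : Finset (Fin n)}

/-- The invariant of the truncated projected CG iteration. `W` is the span of the previous projected
residuals, which equals the span of the previous search directions. -/
structure PCGInvariant (A : Matrix (Fin n) (Fin n) ℝ) (b c : Fin n → ℝ)
    (J₀ Jm Jp : Finset (Fin n)) (x₀ : Fin n → ℝ) (s : PCGState n)
    (W : Submodule ℝ (Fin n → ℝ)) : Prop where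
  mem_face : s.x ∈ face J₀ Jm Jp
  le : smoothPart A (b - c) s.x ≤ smoothPart A (b - c) x₀
  r_eq : s.r = grad A (b - c) s.x
  p_eq : s.p = zeroOn J₀ s.r
  p_ne_zero : s.p ≠ 0
  apply_eq_zero : ∀ w ∈ W, ∀ j ∈ J₀, w j = 0
  dotProduct_p : ∀ w ∈ W, w ⬝ᵥ s.p = 0
  dotProduct_d : ∀ w ∈ W, w ⬝ᵥ (A *ᵥ s.d) = 0
  zeroOn_mulVec : ∀ w ∈ W, ∃ w' ∈ W, ∃ t : ℝ, zeroOn J₀ (A *ᵥ w) = w' + t • s.p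
  d_add_p : s.d + s.p ∈ W

namespace PCGInvariant

variable {s : PCGState n} {W : Submodule ℝ (Fin n → ℝ)}

theorem p_apply (h : PCGInvariant A b c J₀ Jm Jp x₀ s W) : ∀ j ∈ J₀, s.p j = 0 := by
  intro j hj
  simp [h.p_eq, zeroOn, hj]

theorem d_apply (h : PCGInvariant A b c J₀ Jm Jp x₀ s W) : ∀ j ∈ J₀, s.d j = 0 := by
  intro j hj
  have := h.apply_eq_zero _ h.d_add_p j hj
  simpa [h.p_apply j hj] using this

theorem d_dot_p (h : PCGInvariant A b c J₀ Jm Jp x₀ s W) : s.d ⬝ᵥ s.p = -(s.p ⬝ᵥ s.p) := by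
  have := h.dotProduct_p _ h.d_add_p
  rw [add_dotProduct] at this
  linarith

theorem grad_dot_d (h : PCGInvariant A b c J₀ Jm Jp x₀ s W) :
    grad A (b - c) s.x ⬝ᵥ s.d = -(s.p ⬝ᵥ s.p) := by
  rw [← h.d_dot_p, ← h.r_eq, dotProduct_comm, h.p_eq, dotProduct_zeroOn _ h.d_apply]

theorem p_dot_Ad (h : PCGInvariant A b c J₀ Jm Jp x₀ s W) :
    s.p ⬝ᵥ (A *ᵥ s.d) = -(s.d ⬝ᵥ (A *ᵥ s.d)) := by
  have := h.dotProduct_d _ h.d_add_p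
  rw [add_dotProduct] at this
  linarith

theorem pp_pos (h : PCGInvariant A b c J₀ Jm Jp x₀ s W) : 0 < s.p ⬝ᵥ s.p :=
  lt_of_le_of_ne (Finset.sum_nonneg fun _ _ => mul_self_nonneg _)
    (Ne.symm (mt dotProduct_self_eq_zero.1 h.p_ne_zero))

/-- Along `d` the slope is `-‖p‖²`, because `d + p` lies in `W` and so is orthogonal to `p`. -/
theorem smoothPart_eq (hA : A.PosSemidef) (h : PCGInvariant A b c J₀ Jm Jp x₀ s W) (α : ℝ) :
    smoothPart A (b - c) (s.x + α • s.d) = smoothPart A (b - c) s.x - α * (s.p ⬝ᵥ s.p) +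
      α ^ 2 / 2 * (s.d ⬝ᵥ (A *ᵥ s.d)) := by
  rw [smoothPart_add_smul hA, h.grad_dot_d]; ring

theorem smoothPart_le (hA : A.PosSemidef) (h : PCGInvariant A b c J₀ Jm Jp x₀ s W) {α : ℝ}
    (hα : 0 ≤ α) (hle : α * (s.d ⬝ᵥ (A *ᵥ s.d)) ≤ s.p ⬝ᵥ s.p) :
    smoothPart A (b - c) (s.x + α • s.d) ≤ smoothPart A (b - c) x₀ := by
  rw [h.smoothPart_eq hA]
  have := h.le
  have hp := h.pp_pos
  nlinarith [mul_le_mul_of_nonneg_left hle hα, mul_nonneg hα hp.le]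

theorem grad_next (h : PCGInvariant A b c J₀ Jm Jp x₀ s W) (α : ℝ) :
    s.r + α • (A *ᵥ s.d) = grad A (b - c) (s.x + α • s.d) := by
  rw [h.r_eq]
  simp only [grad, Matrix.mulVec_add, Matrix.mulVec_smul]
  abel

/-- A full CG step preserves the invariant. -/
theorem next (hA : A.PosSemidef) (h : PCGInvariant A b c J₀ Jm Jp x₀ s W)
    {α : ℝ} {p' : Fin n → ℝ} (hα : α = s.p ⬝ᵥ s.p / (s.d ⬝ᵥ (A *ᵥ s.d)))
    (hd : 0 < s.d ⬝ᵥ (A *ᵥ s.d)) (hmem : s.x + α • s.d ∈ face J₀ Jm Jp)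
    (hp' : p' = zeroOn J₀ (s.r + α • (A *ᵥ s.d))) (hne : p' ≠ 0) :
    PCGInvariant A b c J₀ Jm Jp x₀
      ⟨s.x + α • s.d, s.r + α • (A *ᵥ s.d), p', -p' + (p' ⬝ᵥ p' / (s.p ⬝ᵥ s.p)) • s.d⟩
      (W ⊔ Submodule.span ℝ {s.p}) := by
  have hpp := h.pp_pos
  have hα0 : 0 < α := by rw [hα]; positivity
  have hαd : α * (s.d ⬝ᵥ (A *ᵥ s.d)) = s.p ⬝ᵥ s.p := by rw [hα]; field_simp
  have hp'' : p' = s.p + α • zeroOn J₀ (A *ᵥ s.d) := by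
    rw [hp', zeroOn_add_smul, ← h.p_eq]
  have hPAd : zeroOn J₀ (A *ᵥ s.d) = α⁻¹ • (p' - s.p) := by
    rw [hp'', add_sub_cancel_left, smul_smul, inv_mul_cancel₀ hα0.ne', one_smul]
  have hW' : ∀ w ∈ W ⊔ Submodule.span ℝ {s.p}, ∃ u ∈ W, ∃ t : ℝ, w = u + t • s.p := by
    intro w hw
    obtain ⟨u, hu, z, hz, rfl⟩ := Submodule.mem_sup.1 hw
    obtain ⟨t, rfl⟩ := Submodule.mem_span_singleton.1 hz
    exact ⟨u, hu, t, rfl⟩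
  have hmemW : ∀ u ∈ W, u ∈ W ⊔ Submodule.span ℝ {s.p} := fun u hu => Submodule.mem_sup_left hu
  have hmemp : s.p ∈ W ⊔ Submodule.span ℝ {s.p} :=
    Submodule.mem_sup_right (Submodule.mem_span_singleton_self _)
  have horthW : ∀ u ∈ W, u ⬝ᵥ p' = 0 := fun u hu => by
    rw [hp'', dotProduct_add, dotProduct_smul, h.dotProduct_p u hu,
      dotProduct_zeroOn _ (h.apply_eq_zero u hu), h.dotProduct_d u hu]
    simp
  have horthp : s.p ⬝ᵥ p' = 0 := by
    rw [hp'', dotProduct_add, dotProduct_smul, dotProduct_zeroOn _ h.p_apply, h.p_dot_Ad,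
      smul_eq_mul]
    linarith
  have horth : ∀ w ∈ W ⊔ Submodule.span ℝ {s.p}, w ⬝ᵥ p' = 0 := by
    intro w hw
    obtain ⟨u, hu, t, rfl⟩ := hW' w hw
    rw [add_dotProduct, smul_dotProduct, horthW u hu, horthp]; simp
  have hp'0 : ∀ j ∈ J₀, p' j = 0 := fun j hj => by simp [hp', zeroOn, hj]
  have hdW : s.d ∈ W ⊔ Submodule.span ℝ {s.p} := by
    have := Submodule.sub_mem _ (hmemW _ h.d_add_p) hmemp
    simpa using this
  -- The projection of `Au` lies in `W + span p`, which is orthogonal to the new residual; so `u` is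
  -- conjugate to `p'` as well as to `d`.
  have hconjW : ∀ u ∈ W, u ⬝ᵥ (A *ᵥ (-p' + (p' ⬝ᵥ p' / (s.p ⬝ᵥ s.p)) • s.d)) = 0 := by
    intro u hu
    obtain ⟨w', hw', t, ht⟩ := h.zeroOn_mulVec u hu
    have h1 : u ⬝ᵥ (A *ᵥ p') = 0 := by
      rw [dotProduct_mulVec_symm hA, ← dotProduct_zeroOn _ hp'0, ht, dotProduct_comm]
      refine horth _ (Submodule.add_mem _ (hmemW _ hw') (Submodule.smul_mem _ _ hmemp))
    rw [Matrix.mulVec_add, Matrix.mulVec_neg, Matrix.mulVec_smul, dotProduct_add, dotProduct_neg,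
      dotProduct_smul, h1, h.dotProduct_d u hu]
    simp
  -- The ratio of squared residual norms is exactly what makes the new direction conjugate to `d`,
  -- since the projection of `Ad` is `α⁻¹ (p' - p)`.
  have hconjd : s.d ⬝ᵥ (A *ᵥ (-p' + (p' ⬝ᵥ p' / (s.p ⬝ᵥ s.p)) • s.d)) = 0 := by
    have h1 : s.d ⬝ᵥ (A *ᵥ p') = α⁻¹ * (p' ⬝ᵥ p') := by
      rw [dotProduct_mulVec_symm hA, ← dotProduct_zeroOn _ hp'0, hPAd, dotProduct_smul,
        dotProduct_sub, dotProduct_comm p' s.p, horthp, sub_zero, smul_eq_mul]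
    rw [Matrix.mulVec_add, Matrix.mulVec_neg, Matrix.mulVec_smul, dotProduct_add, dotProduct_neg,
      dotProduct_smul, h1, hα, smul_eq_mul]
    field_simp
    ring
  have hconjp : s.p ⬝ᵥ (A *ᵥ (-p' + (p' ⬝ᵥ p' / (s.p ⬝ᵥ s.p)) • s.d)) = 0 := by
    have := hconjW _ h.d_add_p
    rw [add_dotProduct, hconjd] at this
    linarith
  refine ⟨hmem, h.smoothPart_le hA hα0.le hαd.le, h.grad_next α, hp', hne, ?_, horth, ?_, ?_, ?_⟩
  · intro w hw j hj
    obtain ⟨u, hu, t, rfl⟩ := hW' w hw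
    simp [h.apply_eq_zero u hu j hj, h.p_apply j hj]
  · intro w hw
    obtain ⟨u, hu, t, rfl⟩ := hW' w hw
    simp only [add_dotProduct, smul_dotProduct]
    rw [hconjW u hu, hconjp]; simp
  · intro w hw
    obtain ⟨u, hu, t, rfl⟩ := hW' w hw
    obtain ⟨u', hu', t', ht'⟩ := h.zeroOn_mulVec u hu
    -- Write `p = (d + p) - d`: the first term is in `W`, and the image of the second is a
    -- combination of `p` and `p'`.
    obtain ⟨v', hv', q', hq'⟩ := h.zeroOn_mulVec _ h.d_add_p
    rw [Matrix.mulVec_add] at hq'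
    have hsum := zeroOn_add_smul J₀ (A *ᵥ s.d) (A *ᵥ s.p) 1
    rw [one_smul, one_smul, hq', hPAd] at hsum
    have hPAp : zeroOn J₀ (A *ᵥ s.p) = v' + q' • s.p - α⁻¹ • (p' - s.p) := by
      rw [hsum]; abel
    refine ⟨u' + t' • s.p + t • (v' + q' • s.p + α⁻¹ • s.p), ?_, t * -α⁻¹, ?_⟩
    · have hs := fun r : ℝ => Submodule.smul_mem _ r hmemp
      exact Submodule.add_mem _ (Submodule.add_mem _ (hmemW _ hu') (hs _))
        (Submodule.smul_mem _ _ (Submodule.add_mem _ (Submodule.add_mem _ (hmemW _ hv') (hs _))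
          (hs _)))
    · rw [Matrix.mulVec_add, Matrix.mulVec_smul, zeroOn_add_smul, ht', hPAp]
      module
  · have : -p' + (p' ⬝ᵥ p' / (s.p ⬝ᵥ s.p)) • s.d + p' = (p' ⬝ᵥ p' / (s.p ⬝ᵥ s.p)) • s.d := by abel
    simp only [this]
    exact Submodule.smul_mem _ _ hdW

/-- A nonzero `p` is orthogonal to `W`, hence not in it. This dimension is the variant that ends the
CG loop. -/
theorem finrank_lt (h : PCGInvariant A b c J₀ Jm Jp x₀ s W) :
    Module.finrank ℝ W < Module.finrank ℝ ↥(W ⊔ Submodule.span ℝ {s.p}) := by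
  refine Submodule.finrank_lt_finrank_of_lt (lt_of_le_of_ne le_sup_left fun he => ?_)
  have hm : s.p ∈ W := by
    rw [he]; exact Submodule.mem_sup_right (Submodule.mem_span_singleton_self _)
  exact h.pp_pos.ne' (h.dotProduct_p _ hm)

end PCGInvariant

theorem tpcg1Step_eq {s : PCGState n} {a : EReal} {α : ℝ}
    (ha : cgLength A s.p s.d = Part.some a)
    (hα : min a (truncLength J₀ Jm Jp s.x s.d) = α) (hp : s.p ⬝ᵥ s.p ≠ 0) :
    tpcg1Step A J₀ Jm Jp ε s = Part.some (
      if (α : EReal) < a then Sum.inl (s.x + α • s.d)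
      else if ‖zeroOn J₀ (s.r + α • (A *ᵥ s.d))‖ ≤ ε then Sum.inl (s.x + α • s.d)
      else Sum.inr ⟨s.x + α • s.d, s.r + α • (A *ᵥ s.d), zeroOn J₀ (s.r + α • (A *ᵥ s.d)),
        -zeroOn J₀ (s.r + α • (A *ᵥ s.d)) + (zeroOn J₀ (s.r + α • (A *ᵥ s.d)) ⬝ᵥ
          zeroOn J₀ (s.r + α • (A *ᵥ s.d)) / (s.p ⬝ᵥ s.p)) • s.d⟩) := by
  have hf : finiteValue (min a (truncLength J₀ Jm Jp s.x s.d)) = Part.some α := by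
    rw [hα]; simp [finiteValue]
  simp only [tpcg1Step, ha, Part.bind_some, hf, partDiv, hp, if_false]
  split_ifs <;> rfl

/-- One pass of the first subroutine either stops at an admissible point or makes progress. -/
theorem tpcg1Step_spec (hA : A.PosSemidef)
    (hbdd : ∃ m, ∀ y ∈ face J₀ Jm Jp, m ≤ smoothPart A (b - c) y) (hε : 0 ≤ ε)
    {s : PCGState n} {W : Submodule ℝ (Fin n → ℝ)} (h : PCGInvariant A b c J₀ Jm Jp x₀ s W) :
    (∃ y, Sum.inl y ∈ tpcg1Step A J₀ Jm Jp ε s ∧ y ∈ face J₀ Jm Jp ∧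
      smoothPart A (b - c) y ≤ smoothPart A (b - c) x₀ ∧
      (‖zeroOn J₀ (grad A (b - c) y)‖ ≤ ε ∨ ∃ j ∉ J₀, y j = 0)) ∨
    ∃ s', Sum.inr s' ∈ tpcg1Step A J₀ Jm Jp ε s ∧
      ∃ W', PCGInvariant A b c J₀ Jm Jp x₀ s' W' ∧
        Module.finrank ℝ W < Module.finrank ℝ W' := by
  have hpp := h.pp_pos
  set t := truncLength J₀ Jm Jp s.x s.d with ht
  have ht0 : 0 ≤ t := truncLength_nonneg h.mem_face
  have hdd := dotProduct_mulVec_self_nonneg hA s.d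
  -- Truncated exit, shared by zero and positive curvature: a step shorter than the CG length does
  -- not raise the quadratic.
  have htrunc : ∀ a : EReal, cgLength A s.p s.d = Part.some a → t < a →
      (∀ α : ℝ, (α : EReal) < a → α * (s.d ⬝ᵥ (A *ᵥ s.d)) ≤ s.p ⬝ᵥ s.p) →
      ∃ y, Sum.inl y ∈ tpcg1Step A J₀ Jm Jp ε s ∧ y ∈ face J₀ Jm Jp ∧
      smoothPart A (b - c) y ≤ smoothPart A (b - c) x₀ ∧
      (‖zeroOn J₀ (grad A (b - c) y)‖ ≤ ε ∨ ∃ j ∉ J₀, y j = 0) := by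
    intro a ha hta hle
    lift t to ℝ using ⟨hta.ne_top, (EReal.bot_lt_zero.trans_le ht0).ne'⟩ with α hα
    have hα0 : 0 ≤ α := EReal.coe_nonneg.1 ht0
    refine ⟨s.x + α • s.d, ?_, add_smul_mem_face h.mem_face h.d_apply hα0 ht.le,
      h.smoothPart_le hA hα0 (hle α hta),
      Or.inr (exists_eq_zero_of_truncLength_eq h.mem_face h.d_apply hα0 ht.symm)⟩
    rw [tpcg1Step_eq ha (α := α) (by rw [← ht]; exact min_eq_right hta.le) hpp.ne', if_pos hta]
    exact Part.mem_some _
  rcases hdd.eq_or_lt with hd0 | hd0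
  · left
    refine htrunc ⊤ (by simp [cgLength, h.p_ne_zero, ← hd0]) ?_ fun α _ => by
      rw [← hd0, mul_zero]; exact hpp.le
    rw [lt_top_iff_ne_top]
    intro htop
    obtain ⟨m, hm⟩ := hbdd
    -- With zero curvature and unlimited truncation length, this step length would bring the
    -- quadratic down to `m - 1`, below its lower bound on the face.
    have h1 := hm _ (add_smul_mem_face h.mem_face h.d_apply (d := s.d)
      (α := (smoothPart A (b - c) s.x - m + 1) / (s.p ⬝ᵥ s.p))
      (by have := hm _ h.mem_face; apply div_nonneg <;> linarith)
      (by rw [← ht, htop]; exact le_top))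
    rw [h.smoothPart_eq hA, ← hd0, div_mul_cancel₀ _ hpp.ne'] at h1
    linarith
  · have ha : cgLength A s.p s.d =
        Part.some ((s.p ⬝ᵥ s.p / (s.d ⬝ᵥ (A *ᵥ s.d)) : ℝ) : EReal) := by
      simp [cgLength, partDiv, hd0.ne']
    set α := s.p ⬝ᵥ s.p / (s.d ⬝ᵥ (A *ᵥ s.d)) with hα
    have hα0 : 0 ≤ α := by positivity
    rcases lt_or_ge t α with hlt | hge
    · left
      refine htrunc α ha hlt fun β hβ => ?_
      rw [EReal.coe_lt_coe_iff, hα, lt_div_iff₀ hd0] at hβ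
      exact hβ.le
    · have hstep := tpcg1Step_eq (ε := ε) ha (α := α) (min_eq_left hge) hpp.ne'
      have hmem := add_smul_mem_face h.mem_face h.d_apply hα0 hge
      rw [if_neg (lt_irrefl _)] at hstep
      rw [hstep]
      split_ifs with hle
      · left
        refine ⟨_, Part.mem_some _, hmem, h.smoothPart_le hA hα0 ?_, Or.inl ?_⟩
        · rw [hα, div_mul_cancel₀ _ hd0.ne']
        · rwa [h.grad_next] at hle
      · right
        refine ⟨_, Part.mem_some _, _, h.next hA hα hd0 hmem rfl ?_, h.finrank_lt⟩
        rintro h0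
        rw [h0, norm_zero] at hle
        exact hle hε

/-- The first subroutine terminates. -/
theorem tpcg1_spec (hA : A.PosSemidef)
    (hbdd : ∃ m, ∀ y ∈ face J₀ Jm Jp, m ≤ smoothPart A (b - c) y) (hε : 0 ≤ ε)
    (hx : x₀ ∈ face J₀ Jm Jp) (hne : zeroOn J₀ (grad A (b - c) x₀) ≠ 0) :
    ∃ y ∈ tpcg1 A b c J₀ Jm Jp x₀ ε, y ∈ face J₀ Jm Jp ∧
      smoothPart A (b - c) y ≤ smoothPart A (b - c) x₀ ∧
      (‖zeroOn J₀ (grad A (b - c) y)‖ ≤ ε ∨ ∃ j ∉ J₀, y j = 0) := by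
  have hle : ∀ W : Submodule ℝ (Fin n → ℝ), Module.finrank ℝ W ≤ n := fun W => by
    simpa using W.finrank_le
  have hr : A *ᵥ x₀ - b + c = grad A (b - c) x₀ := by simp only [grad]; abel
  simp only [tpcg1, hr]
  refine exists_mem_fix (m := n) (Inv := fun m s => ∃ W, PCGInvariant A b c J₀ Jm Jp x₀ s W ∧
    m = n - Module.finrank ℝ W) ?_ ⟨⊥, ⟨hx, le_rfl, rfl, rfl, hne, ?_, ?_, ?_, ?_, ?_⟩, ?_⟩
  · rintro m s ⟨W, hW, rfl⟩
    rcases tpcg1Step_spec hA hbdd hε hW with h | ⟨s', hs', W', hW', hlt⟩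
    · exact Or.inl h
    · have := hle W'
      exact Or.inr ⟨s', _, by omega, hs', W', hW', rfl⟩
  all_goals simp
  exact ⟨0, by ext i; simp [zeroOn]⟩

/-! ### The second subroutine -/

theorem face_signSets_subset {y : Fin n → ℝ} (hy : y ∈ face J₀ Jm Jp) :
    face (zeroSet y) (negSet y) (posSet y) ⊆ face J₀ Jm Jp := by
  intro z hz
  simp only [face, zeroSet, negSet, posSet, Finset.mem_filter, Finset.mem_univ, true_and,
    Set.mem_ofPred_eq] at hz ⊢
  refine ⟨fun j hj => hz.1 j (hy.1 j hj), fun j hj => ?_, fun j hj => ?_⟩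
  · rcases (hy.2.1 j hj).eq_or_lt with h | h
    · exact (hz.1 j h).le
    · exact hz.2.1 j h
  · rcases (hy.2.2 j hj).eq_or_lt with h | h
    · exact (hz.1 j h.symm).ge
    · exact hz.2.2 j h

theorem mem_face_signSets (y : Fin n → ℝ) : y ∈ face (zeroSet y) (negSet y) (posSet y) := by
  refine ⟨fun j hj => ?_, fun j hj => ?_, fun j hj => ?_⟩
  · simpa [zeroSet] using hj
  · simp only [negSet, Finset.mem_filter, Finset.mem_univ, true_and] at hj; exact hj.le
  · simp only [posSet, Finset.mem_filter, Finset.mem_univ, true_and] at hj; exact hj.le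

theorem subset_zeroSet {y : Fin n → ℝ} (hy : y ∈ face J₀ Jm Jp) : J₀ ⊆ zeroSet y := by
  intro j hj
  simpa [zeroSet] using hy.1 j hj

/-- The second subroutine terminates. If it does not return its starting point at once, then it
returns a point whose gradient is small on its support. -/
theorem tpcg2_spec (hA : A.PosSemidef)
    (hbdd : ∃ m, ∀ y ∈ face J₀ Jm Jp, m ≤ smoothPart A (b - c) y) (hε : 0 ≤ ε)
    (hx : x₀ ∈ face J₀ Jm Jp) (hlt : ε < ‖zeroOn J₀ (grad A (b - c) x₀)‖) :
    ∃ y ∈ tpcg2 A b c J₀ Jm Jp x₀ ε, y ∈ face J₀ Jm Jp ∧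
      smoothPart A (b - c) y ≤ smoothPart A (b - c) x₀ ∧
      ‖zeroOn (zeroSet y) (grad A (b - c) y)‖ ≤ ε := by
  have hr : ∀ x, A *ᵥ x - b + c = grad A (b - c) x := fun x => by simp only [grad]; abel
  have hcard : ∀ J : Finset (Fin n), J.card ≤ n := fun J => by simpa using J.card_le_univ
  -- While the gradient is large, `m` exceeds the number of coordinates not yet frozen; a small
  -- gradient stops the loop at the next test, so `m` is then free. The fourth clause ensures that a
  -- return happens only when `J₀ = I₀(x)`, although the initial `J₀` may be smaller.
  let Inv : ℕ → FaceState n → Prop := fun m s =>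
    face s.J₀ s.Jm s.Jp ⊆ face J₀ Jm Jp ∧ s.x ∈ face s.J₀ s.Jm s.Jp ∧
    smoothPart A (b - c) s.x ≤ smoothPart A (b - c) x₀ ∧
    (ε < ‖zeroOn s.J₀ (grad A (b - c) s.x)‖ ∨ s.J₀ = zeroSet s.x) ∧
    (n + 1 ≤ m + s.J₀.card ∨ ‖zeroOn s.J₀ (grad A (b - c) s.x)‖ ≤ ε)
  have hinit : Inv (n + 1) ⟨J₀, Jm, Jp, x₀⟩ :=
    ⟨subset_rfl, hx, le_rfl, Or.inl hlt, Or.inl (by omega)⟩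
  refine exists_mem_fix ?_ hinit
  rintro m ⟨K₀, Km, Kp, x⟩ ⟨hsub, hmem, hle, hor, hm⟩
  simp only at hsub hmem hle hor hm
  simp only [tpcg2Step, hr]
  by_cases hsmall_grad : ‖zeroOn K₀ (grad A (b - c) x)‖ ≤ ε
  · left
    rw [if_pos hsmall_grad]
    obtain rfl := hor.resolve_left hsmall_grad.not_gt
    exact ⟨x, Part.mem_some _, hsub hmem, hle, hsmall_grad⟩
  · right
    rw [if_neg hsmall_grad]
    have hm' := hm.resolve_right hsmall_grad
    rw [not_le] at hsmall_grad
    obtain ⟨q, hq⟩ := hbdd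
    obtain ⟨y, hy, hyf, hyle, hend⟩ := tpcg1_spec hA ⟨q, fun y hy => hq y (hsub hy)⟩ hε hmem
      (norm_pos_iff.1 (hε.trans_lt hsmall_grad))
    have hK := subset_zeroSet hyf
    have hc := hcard K₀
    refine ⟨⟨zeroSet y, negSet y, posSet y, y⟩, m - 1, by omega, Part.mem_map _ hy,
      (face_signSets_subset hyf).trans hsub, mem_face_signSets y, hyle.trans hle, Or.inr rfl, ?_⟩
    rcases hend with hend | ⟨j, hj, hyj⟩
    · exact Or.inr ((norm_zeroOn_anti hK _).trans hend)
    · left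
      have : K₀.card < (zeroSet y).card := Finset.card_lt_card
        ⟨hK, fun hsub => hj (hsub (by simp [zeroSet, hyj]))⟩
      simp only
      omega

end L1QP

/-! ### The error bound and its least constant -/

namespace L1QP

variable {n : ℕ} {A : Matrix (Fin n) (Fin n) ℝ} {b c x x₀ : Fin n → ℝ} {τ : ℝ}

theorem specNorm_nonneg (A : Matrix (Fin n) (Fin n) ℝ) : 0 ≤ specNorm A := norm_nonneg _

theorem dotProduct_mulVec_self_le (A : Matrix (Fin n) (Fin n) ℝ) (v : Fin n → ℝ) :
    v ⬝ᵥ (A *ᵥ v) ≤ specNorm A * (v ⬝ᵥ v) := by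
  have h1 : inner ℝ (WithLp.toLp 2 v)
      (Matrix.toEuclideanCLM (n := Fin n) (𝕜 := ℝ) A (WithLp.toLp 2 v)) = v ⬝ᵥ (A *ᵥ v) := by
    simp [EuclideanSpace.inner_eq_star_dotProduct, dotProduct_comm]
  have h2 : ‖WithLp.toLp 2 v‖ * ‖WithLp.toLp 2 v‖ = v ⬝ᵥ v := by
    rw [← real_inner_self_eq_norm_mul_norm, EuclideanSpace.inner_eq_star_dotProduct]
    simp
  rw [← h1, ← h2, specNorm]
  refine (real_inner_le_norm _ _).trans ?_
  have := (Matrix.toEuclideanCLM (n := Fin n) (𝕜 := ℝ) A).le_opNorm (WithLp.toLp 2 v)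
  nlinarith [norm_nonneg (WithLp.toLp 2 v)]

theorem dotProduct_le_norm_mul_norm (u v : Fin n → ℝ) : u ⬝ᵥ v ≤ n * (‖u‖ * ‖v‖) := by
  have : ∀ i ∈ Finset.univ, u i * v i ≤ ‖u‖ * ‖v‖ := fun i _ => by
    refine (le_abs_self _).trans ?_
    rw [abs_mul]
    exact mul_le_mul (norm_le_pi_norm u i) (norm_le_pi_norm v i) (abs_nonneg _) (norm_nonneg _)
  simpa [dotProduct] using Finset.sum_le_card_nsmul _ _ _ this

theorem normOn_sq (J : Finset (Fin n)) (v : Fin n → ℝ) : normOn J v ^ 2 = ∑ i ∈ J, v i ^ 2 :=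
  Real.sq_sqrt (Finset.sum_nonneg fun _ _ => sq_nonneg _)

theorem normOn_nonneg (J : Finset (Fin n)) (v : Fin n → ℝ) : 0 ≤ normOn J v := Real.sqrt_nonneg _

/-- A linear map between finite-dimensional spaces has a bounded generalized inverse. -/
theorem exists_bounded_preimage {V : Type*} [NormedAddCommGroup V] [NormedSpace ℝ V]
    [FiniteDimensional ℝ V] (L : V →ₗ[ℝ] V) :
    ∃ K : ℝ, 0 ≤ K ∧ ∀ w, ∃ u, L u = L w ∧ ‖u‖ ≤ K * ‖L w‖ := by
  obtain ⟨g, hg⟩ := L.rangeRestrict.exists_rightInverse_of_surjective L.range_rangeRestrict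
  refine ⟨‖LinearMap.toContinuousLinearMap g‖,
    (LinearMap.toContinuousLinearMap g).opNorm_nonneg, fun w =>
    ⟨g (L.rangeRestrict w), ?_, ?_⟩⟩
  · exact congrArg Subtype.val (LinearMap.congr_fun hg (L.rangeRestrict w))
  · exact (LinearMap.toContinuousLinearMap g).le_opNorm (L.rangeRestrict w)

/-- `zeroOn J` as a linear map. -/
def zeroOnLinear (J : Finset (Fin n)) : (Fin n → ℝ) →ₗ[ℝ] (Fin n → ℝ) where
  toFun := zeroOn J
  map_add' r w := by simpa using zeroOn_add_smul J r w 1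
  map_smul' t r := by ext i; simp [zeroOn]

theorem zeroOn_eq_self {J : Finset (Fin n)} (h : ∀ j ∈ J, x j = 0) : zeroOn J x = x := by
  ext i
  by_cases hi : i ∈ J <;> simp [zeroOn, hi, h]

/-- On a coordinate subspace, the quadratic `f + cᵀx` has either a minimizer and then a quadratic
error bound, or a gradient bounded away from zero. -/
theorem exists_quadratic_errorBound (hA : A.PosSemidef) (b : Fin n → ℝ) (J : Finset (Fin n)) :
    (∃ K : ℝ, 0 ≤ K ∧ ∃ z : Fin n → ℝ, ∀ x, (∀ j ∈ J, x j = 0) →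
      smoothPart A b z ≤ smoothPart A b x ∧
      smoothPart A b x - smoothPart A b z ≤ K * ‖zeroOn J (grad A b x)‖ ^ 2) ∨
    ∃ δ : ℝ, 0 < δ ∧ ∀ x, (∀ j ∈ J, x j = 0) → δ ≤ ‖zeroOn J (grad A b x)‖ := by
  let L : (Fin n → ℝ) →ₗ[ℝ] (Fin n → ℝ) := zeroOnLinear J ∘ₗ A.mulVecLin ∘ₗ zeroOnLinear J
  have hL : ∀ x, L x = zeroOn J (A *ᵥ zeroOn J x) := fun _ => rfl
  have hL' : ∀ x, (∀ j ∈ J, x j = 0) → L x = zeroOn J (A *ᵥ x) := fun x hx => by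
    rw [hL, zeroOn_eq_self hx]
  have hz : ∀ z : Fin n → ℝ, ∀ j ∈ J, zeroOn J z j = 0 := fun z j hj => by simp [zeroOn, hj]
  have hgrad : ∀ x, (∀ j ∈ J, x j = 0) → zeroOn J (grad A b x) = L x - zeroOn J b := fun x hx => by
    rw [hL' x hx]; exact (zeroOnLinear J).map_sub _ _
  by_cases hb : zeroOn J b ∈ LinearMap.range L
  · left
    obtain ⟨z, hzb⟩ := hb
    have hLz : L (zeroOn J z) = zeroOn J b := by rw [hL' _ (hz z), ← hL, hzb]
    obtain ⟨K, hK, hinv⟩ := exists_bounded_preimage L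
    refine ⟨n * K, by positivity, zeroOn J z, fun x hx => ?_⟩
    have hw : ∀ j ∈ J, (x - zeroOn J z) j = 0 := fun j hj => by simp [hx j hj, hz z j hj]
    have hgz : grad A b (zeroOn J z) ⬝ᵥ (x - zeroOn J z) = 0 := by
      rw [dotProduct_comm, ← dotProduct_zeroOn _ hw, hgrad _ (hz z), hLz, sub_self,
        dotProduct_zero]
    have hexp := smoothPart_add hA b (zeroOn J z) (x - zeroOn J z)
    rw [add_sub_cancel, hgz] at hexp
    set w := x - zeroOn J z with hw'
    have hLw : L w = zeroOn J (grad A b x) := by rw [hgrad x hx, hw', map_sub, hLz]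
    have hpos := dotProduct_mulVec_self_nonneg hA w
    obtain ⟨u, hu, hun⟩ := hinv w
    have hu' : zeroOn J (A *ᵥ zeroOn J u) = zeroOn J (A *ᵥ w) := by rw [← hL, ← hL' w hw, hu]
    -- Only the image of `w` is controlled, not `w` itself; symmetry allows the bounded preimage `u`
    -- in its place. The factor `n` comes from using maximum norms.
    have hbound : w ⬝ᵥ (A *ᵥ w) ≤ n * K * ‖zeroOn J (grad A b x)‖ ^ 2 := by
      calc w ⬝ᵥ (A *ᵥ w) = zeroOn J u ⬝ᵥ L w := by
            rw [← dotProduct_zeroOn _ hw, ← hu', dotProduct_zeroOn _ hw,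
              dotProduct_mulVec_symm hA, hL' w hw, dotProduct_zeroOn _ (hz u)]
        _ ≤ n * (‖zeroOn J u‖ * ‖L w‖) := dotProduct_le_norm_mul_norm _ _
        _ ≤ n * ((K * ‖L w‖) * ‖L w‖) := by
            have : ‖zeroOn J u‖ ≤ K * ‖L w‖ := by
              refine le_trans ?_ hun
              have h := norm_zeroOn_anti (Finset.empty_subset J) u
              rwa [zeroOn_eq_self (J := ∅) (by simp)] at h
            gcongr
        _ = n * K * ‖zeroOn J (grad A b x)‖ ^ 2 := by rw [hLw]; ring
    constructor <;> linarith
  · right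
    have hcl : IsClosed (LinearMap.range L : Set (Fin n → ℝ)) :=
      Submodule.closed_of_finiteDimensional _
    -- The projected gradients are `L x - P b`, so they stay at least the distance from `P b` to the
    -- range of `L` away from zero.
    refine ⟨Metric.infDist (zeroOn J b) (LinearMap.range L),
      (hcl.notMem_iff_infDist_pos ⟨0, Submodule.zero_mem _⟩).1 hb, fun x hx => ?_⟩
    rw [hgrad x hx, ← dist_eq_norm, dist_comm]
    exact Metric.infDist_le_dist_of_mem ⟨x, rfl⟩

theorem faceMin_le (hopt : ∃ xs, IsOptimal A b τ xs) {y : Fin n → ℝ}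
    (hy : ∀ i ∈ zeroSet x, y i = 0) : faceMin A b τ x ≤ objective A b τ y := by
  obtain ⟨xs, hxs⟩ := hopt
  refine csInf_le ⟨objective A b τ xs, ?_⟩ ⟨y, hy, rfl⟩
  rintro _ ⟨z, -, rfl⟩
  exact hxs z

theorem le_faceMin {m : ℝ} (h : ∀ y, (∀ i ∈ zeroSet x, y i = 0) → m ≤ objective A b τ y) :
    m ≤ faceMin A b τ x := by
  refine le_csInf ⟨_, x, fun i hi => by simpa [zeroSet] using hi, rfl⟩ ?_
  rintro _ ⟨y, hy, rfl⟩
  exact h y hy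

theorem abs_eq_sign_mul (t : ℝ) : |t| = (SignType.sign t : ℝ) * t := by
  rw [mul_comm]; exact (self_mul_sign t).symm

/-- The error bound on the set of points with a given sign pattern. -/
theorem exists_errorBound_of_sign (hA : A.PosSemidef) (hτ : 0 ≤ τ)
    (hopt : ∃ xs, IsOptimal A b τ xs) (x₀ : Fin n → ℝ) (σ : Fin n → SignType) :
    ∃ K : ℝ, 0 ≤ K ∧ ∀ x, (∀ i, SignType.sign (x i) = σ i) →
      objective A b τ x ≤ objective A b τ x₀ →
      objective A b τ x - faceMin A b τ x ≤
        K * normOn (nonzeroSet x) (minSubgrad A b τ x) ^ 2 := by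
  let c : Fin n → ℝ := fun i => τ * (σ i : ℝ)
  let J : Finset (Fin n) := {i | σ i = 0}
  have hc : ∀ x : Fin n → ℝ, (∀ i, SignType.sign (x i) = σ i) → ∀ i, τ * |x i| = c i * x i :=
    fun x hx i => by rw [abs_eq_sign_mul, hx i, mul_assoc]
  have hJ : ∀ x : Fin n → ℝ, (∀ i, SignType.sign (x i) = σ i) → J = zeroSet x := fun x hx => by
    ext i; simp [J, zeroSet, ← hx i]
  have hx0 : ∀ x : Fin n → ℝ, (∀ i, SignType.sign (x i) = σ i) → ∀ j ∈ J, x j = 0 :=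
    fun x hx j hj => by rw [hJ x hx] at hj; simpa [zeroSet] using hj
  have hnorm : ∀ x : Fin n → ℝ, (∀ i, SignType.sign (x i) = σ i) →
      ‖zeroOn J (grad A (b - c) x)‖ ^ 2 ≤
        normOn (nonzeroSet x) (minSubgrad A b τ x) ^ 2 := by
    intro x hx
    refine (sq_le_sq₀ (norm_nonneg _) (normOn_nonneg _ _)).2
      ((pi_norm_le_iff_of_nonneg (normOn_nonneg _ _)).2 fun i => ?_)
    by_cases hi : x i = 0
    · have : i ∈ J := by rw [hJ x hx]; simpa [zeroSet] using hi
      simpa [zeroOn, this] using normOn_nonneg _ _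
    · have hiJ : i ∉ J := fun h => hi (hx0 x hx i h)
      have hg : zeroOn J (grad A (b - c) x) i = minSubgrad A b τ x i := by
        rw [minSubgrad_of_ne_zero hi (hc x hx i)]
        simp only [zeroOn, hiJ, if_false, grad, Pi.sub_apply, Pi.add_apply]
        ring
      rw [hg]
      refine Real.le_sqrt_of_sq_le ?_
      rw [Real.norm_eq_abs, sq_abs]
      exact Finset.single_le_sum (f := fun i => minSubgrad A b τ x i ^ 2)
        (fun _ _ => sq_nonneg _) (by simpa [nonzeroSet] using hi)
  rcases exists_quadratic_errorBound hA (b - c) J with ⟨K, hK, z, hz⟩ | ⟨δ, hδ, hle⟩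
  · refine ⟨K, hK, fun x hx _ => ?_⟩
    have h1 : smoothPart A (b - c) z ≤ faceMin A b τ x := by
      refine le_faceMin fun y hy => ((hz y (by rwa [hJ x hx])).1).trans
        (smoothPart_le_objective fun i => ?_)
      have hs : |(σ i : ℝ)| ≤ 1 := by cases σ i <;> simp
      calc c i * y i ≤ |c i * y i| := le_abs_self _
        _ = τ * (|(σ i : ℝ)| * |y i|) := by
            simp only [c, abs_mul, abs_of_nonneg hτ]; ring
        _ ≤ τ * (1 * |y i|) := by gcongr
        _ = τ * |y i| := by ring
    have h2 := (hz x (hx0 x hx)).2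
    rw [objective_eq_smoothPart (hc x hx)]
    have h3 := mul_le_mul_of_nonneg_left (hnorm x hx) hK
    linarith
  · obtain ⟨xs, hxs⟩ := hopt
    have hM : 0 ≤ objective A b τ x₀ - objective A b τ xs := by linarith [hxs x₀]
    -- The restriction to the level set of `x₀` enters here: the gap is at most `F(x₀) - F(xs)`,
    -- while the squared norm is at least `δ²`.
    refine ⟨(objective A b τ x₀ - objective A b τ xs) / δ ^ 2, by positivity, fun x hx hF => ?_⟩
    have h1 : objective A b τ xs ≤ faceMin A b τ x := le_faceMin fun y _ => hxs y
    have h2 : δ ^ 2 ≤ normOn (nonzeroSet x) (minSubgrad A b τ x) ^ 2 :=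
      (pow_le_pow_left₀ hδ.le (hle x (hx0 x hx)) 2).trans (hnorm x hx)
    calc objective A b τ x - faceMin A b τ x
        ≤ objective A b τ x₀ - objective A b τ xs := by linarith
      _ = (objective A b τ x₀ - objective A b τ xs) / δ ^ 2 * δ ^ 2 := by field_simp
      _ ≤ _ := by gcongr

/-- There is a smallest constant in the error bound. -/
theorem exists_isLeast_errorBound (hA : A.PosSemidef) (hτ : 0 ≤ τ)
    (hopt : ∃ xs, IsOptimal A b τ xs) (x₀ : Fin n → ℝ) :
    ∃ ηs : ℝ, IsLeast {η : ℝ | ErrorBound A b τ x₀ η} ηs := by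
  choose K hK hle using exists_errorBound_of_sign hA hτ hopt x₀
  have hS := specNorm_nonneg A
  have hne : {η : ℝ | ErrorBound A b τ x₀ η}.Nonempty := by
    -- Summing over the finitely many sign patterns gives one constant for all of them.
    refine ⟨2 * specNorm A * ∑ σ, K σ,
      mul_nonneg (by positivity) (Finset.sum_nonneg fun σ _ => hK σ), fun x hx => ?_⟩
    have h1 := hle (fun i => SignType.sign (x i)) x (fun _ => rfl) hx
    have h2 : K (fun i => SignType.sign (x i)) ≤ ∑ σ, K σ :=
      Finset.single_le_sum (fun σ _ => hK σ) (Finset.mem_univ _)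
    calc 2 * specNorm A * (objective A b τ x - faceMin A b τ x)
        ≤ 2 * specNorm A * (K (fun i => SignType.sign (x i)) *
            normOn (nonzeroSet x) (minSubgrad A b τ x) ^ 2) := by gcongr
      _ ≤ 2 * specNorm A * ((∑ σ, K σ) *
            normOn (nonzeroSet x) (minSubgrad A b τ x) ^ 2) := by gcongr
      _ = _ := by ring
  have hcl : IsClosed {η : ℝ | ErrorBound A b τ x₀ η} := by
    have : {η : ℝ | ErrorBound A b τ x₀ η} = Set.Ici 0 ∩
        ⋂ x, ⋂ _ : objective A b τ x ≤ objective A b τ x₀,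
          {η | 2 * specNorm A * (objective A b τ x - faceMin A b τ x) ≤
            η * normOn (nonzeroSet x) (minSubgrad A b τ x) ^ 2} := by
      ext η; simp [ErrorBound]
    rw [this]
    exact isClosed_Ici.inter (isClosed_iInter fun x => isClosed_iInter fun _ =>
      isClosed_le continuous_const (by fun_prop))
  have hbdd : BddBelow {η : ℝ | ErrorBound A b τ x₀ η} := ⟨0, fun η hη => hη.1⟩
  exact ⟨_, hcl.csInf_mem hne hbdd, fun η hη => csInf_le hbdd hη⟩

end L1QP

namespace L1QP

variable {n : ℕ} {A : Matrix (Fin n) (Fin n) ℝ} {b c x x₀ : Fin n → ℝ} {τ ε η : ℝ}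

/-! ### The projected subgradient step -/

theorem projSubgrad_dot_self (A : Matrix (Fin n) (Fin n) ℝ) (b : Fin n → ℝ) (τ : ℝ)
    (x : Fin n → ℝ) : projSubgrad A b τ x ⬝ᵥ projSubgrad A b τ x =
      normOn (zeroSet x) (minSubgrad A b τ x) ^ 2 := by
  simp [normOn_sq, dotProduct, projSubgrad, ← sq]

theorem soft_threshold_identity (hτ : 0 ≤ τ) (g : ℝ) :
    τ * |min (g + τ) (max 0 (g - τ))| - g * min (g + τ) (max 0 (g - τ)) =
      -(min (g + τ) (max 0 (g - τ)) * min (g + τ) (max 0 (g - τ))) := by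
  rcases lt_or_ge (g + τ) 0 with h | h
  · rw [min_eq_left (h.le.trans (le_max_left _ _)), abs_of_neg h]; ring
  · rcases lt_or_ge 0 (g - τ) with h' | h'
    · rw [max_eq_right h'.le, min_eq_right (by linarith), abs_of_pos h']; ring
    · rw [max_eq_left h', min_eq_right h]; simp

/-- The direction moves only zero coordinates, where the absolute value is linear along a ray; hence
`F` is exactly quadratic in the step length `α ≥ 0`. -/
theorem objective_sub_smul_projSubgrad (hA : A.PosSemidef) (b : Fin n → ℝ) (hτ : 0 ≤ τ)
    (x : Fin n → ℝ) {α : ℝ} (hα : 0 ≤ α) :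
    objective A b τ (x - α • projSubgrad A b τ x) = objective A b τ x -
      α * (projSubgrad A b τ x ⬝ᵥ projSubgrad A b τ x) +
      α ^ 2 / 2 * (projSubgrad A b τ x ⬝ᵥ (A *ᵥ projSubgrad A b τ x)) := by
  have h1 := smoothPart_add_smul hA b x (projSubgrad A b τ x) (-α)
  rw [neg_smul, ← sub_eq_add_neg] at h1
  have h2 : τ * ∑ i, |(x - α • projSubgrad A b τ x) i| =
      τ * ∑ i, |x i| + α * (grad A b x ⬝ᵥ projSubgrad A b τ x -
        projSubgrad A b τ x ⬝ᵥ projSubgrad A b τ x) := by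
    simp only [dotProduct, Finset.mul_sum, ← Finset.sum_sub_distrib, ← Finset.sum_add_distrib]
    refine Finset.sum_congr rfl fun i _ => ?_
    by_cases hi : x i = 0
    · have hz : projSubgrad A b τ x i = min (grad A b x i + τ) (max 0 (grad A b x i - τ)) := by
        rw [projSubgrad, if_pos (by simpa [zeroSet] using hi), minSubgrad_of_eq_zero hi]
      have h3 := soft_threshold_identity hτ (grad A b x i)
      rw [← hz] at h3
      simp only [Pi.sub_apply, Pi.smul_apply, smul_eq_mul, hi, zero_sub, abs_neg, abs_mul,
        abs_of_nonneg hα, abs_zero, mul_zero, zero_add]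
      linear_combination α * h3
    · have hz : projSubgrad A b τ x i = 0 := by
        rw [projSubgrad, if_neg (by simpa [zeroSet] using hi)]
      simp [hz]
  rw [objective, objective, h1, h2]
  ring

/-- The curvature along a nonzero projected subgradient is positive. -/
theorem projSubgrad_curvature_pos (hA : A.PosSemidef) (hτ : 0 ≤ τ)
    (hopt : ∃ xs, IsOptimal A b τ xs)
    (hv : 0 < projSubgrad A b τ x ⬝ᵥ projSubgrad A b τ x) :
    0 < projSubgrad A b τ x ⬝ᵥ (A *ᵥ projSubgrad A b τ x) := by
  refine lt_of_le_of_ne (dotProduct_mulVec_self_nonneg hA _) fun h0 => ?_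
  obtain ⟨xs, hxs⟩ := hopt
  have hx := hxs x
  -- Without curvature, this step length would reach the value `F(xs) - 1`.
  have h := hxs (x - ((objective A b τ x - objective A b τ xs + 1) /
    (projSubgrad A b τ x ⬝ᵥ projSubgrad A b τ x)) • projSubgrad A b τ x)
  rw [objective_sub_smul_projSubgrad hA b hτ x (by apply div_nonneg <;> linarith), ← h0,
    div_mul_cancel₀ _ hv.ne'] at h
  linarith

/-- The decrease of the objective in a projected subgradient step with exact line search. -/
theorem objective_projSubgrad_step (hA : A.PosSemidef) (hτ : 0 ≤ τ)
    (hopt : ∃ xs, IsOptimal A b τ xs)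
    (hv : 0 < projSubgrad A b τ x ⬝ᵥ projSubgrad A b τ x) {α : ℝ}
    (hα : α = projSubgrad A b τ x ⬝ᵥ projSubgrad A b τ x /
      (projSubgrad A b τ x ⬝ᵥ (A *ᵥ projSubgrad A b τ x))) :
    objective A b τ (x - α • projSubgrad A b τ x) < objective A b τ x ∧
    projSubgrad A b τ x ⬝ᵥ projSubgrad A b τ x ≤ 2 * specNorm A *
      (objective A b τ x - objective A b τ (x - α • projSubgrad A b τ x)) := by
  have hd := projSubgrad_curvature_pos hA hτ hopt hv
  have hα0 : 0 < α := by rw [hα]; positivity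
  rw [objective_sub_smul_projSubgrad hA b hτ x hα0.le]
  have hαd : α * (projSubgrad A b τ x ⬝ᵥ (A *ᵥ projSubgrad A b τ x)) =
      projSubgrad A b τ x ⬝ᵥ projSubgrad A b τ x := by rw [hα]; field_simp
  have hS := dotProduct_mulVec_self_le A (projSubgrad A b τ x)
  set p := projSubgrad A b τ x ⬝ᵥ projSubgrad A b τ x
  set q := projSubgrad A b τ x ⬝ᵥ (A *ᵥ projSubgrad A b τ x)
  -- The exact step is at least `1/‖A‖`, because the curvature is at most `‖A‖ ‖v^P‖²`.
  have hαS : 1 ≤ α * specNorm A := by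
    by_contra! hlt
    have h1 := mul_le_mul_of_nonneg_left hS hα0.le
    rw [hαd] at h1
    nlinarith
  have hdec : α ^ 2 / 2 * q = α * p / 2 := by rw [← hαd]; ring
  rw [hdec]
  have hαp := mul_pos hα0 hv
  refine ⟨by linarith, ?_⟩
  have h2 := mul_le_mul_of_nonneg_right hαS hv.le
  nlinarith

/-! ### The call of the second subroutine -/

theorem sign_face_abs (A : Matrix (Fin n) (Fin n) ℝ) (b : Fin n → ℝ) (τ : ℝ)
    (x : Fin n → ℝ) {y : Fin n → ℝ}
    (hy : y ∈ face (zeroSetStay A b τ x) (negSet x ∪ zeroSetNeg A b τ x)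
      (posSet x ∪ zeroSetPos A b τ x)) (i : Fin n) :
    τ * |y i| = signCost A b τ x i * y i := by
  unfold signCost
  split_ifs with h1 h2
  · rw [abs_of_nonneg (hy.2.2 i h1)]
  · rw [abs_of_nonpos (hy.2.1 i h2)]; ring
  · have : i ∈ zeroSetStay A b τ x := by
      simp only [posSet, negSet, zeroSetPos, zeroSetNeg, zeroSetStay, Finset.mem_union,
        Finset.mem_filter, Finset.mem_univ, true_and] at h1 h2 ⊢
      push Not at h1 h2
      have hx : x i = 0 := le_antisymm h1.1 h2.1
      exact ⟨hx, h2.2 hx, h1.2 hx⟩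
    simp [hy.1 i this]

theorem mem_sign_face (A : Matrix (Fin n) (Fin n) ℝ) (b : Fin n → ℝ) (τ : ℝ)
    (x : Fin n → ℝ) :
    x ∈ face (zeroSetStay A b τ x) (negSet x ∪ zeroSetNeg A b τ x)
      (posSet x ∪ zeroSetPos A b τ x) := by
  simp only [face, posSet, negSet, zeroSetPos, zeroSetNeg, zeroSetStay, Finset.mem_union,
    Finset.mem_filter, Finset.mem_univ, true_and, Set.mem_ofPred_eq]
  refine ⟨fun j h => h.1, fun j h => ?_, fun j h => ?_⟩
  · rcases h with h | h
    · exact h.le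
    · exact h.1.le
  · rcases h with h | h
    · exact h.le
    · exact h.1.ge

/-- The zero coordinates released from `I₀⁰` receive the sign cost that soft thresholding selects.
Thus the subroutine's initial test sees `v(x)` itself. -/
theorem zeroOn_grad_eq_minSubgrad (A : Matrix (Fin n) (Fin n) ℝ) (b : Fin n → ℝ) (hτ : 0 ≤ τ)
    (x : Fin n → ℝ) :
    zeroOn (zeroSetStay A b τ x) (grad A (b - signCost A b τ x) x) = minSubgrad A b τ x := by
  have hg : grad A (b - signCost A b τ x) x = grad A b x + signCost A b τ x := by
    simp only [grad]; abel
  ext i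
  rw [hg]
  by_cases hx : x i = 0
  · rw [minSubgrad_of_eq_zero hx]
    simp only [zeroOn, signCost, zeroSetStay, posSet, negSet, zeroSetPos, zeroSetNeg,
      Finset.mem_union, Finset.mem_filter, Finset.mem_univ, true_and, hx, lt_irrefl, false_or,
      Pi.add_apply]
    set g := grad A b x i
    rcases lt_or_ge (g + τ) 0 with h | h
    · rw [min_eq_left (h.le.trans (le_max_left _ _)), if_neg (fun h' => absurd h'.2 h.not_ge),
        if_pos h]
    · rcases lt_or_ge 0 (g - τ) with h' | h'
      · rw [max_eq_right h'.le, min_eq_right (by linarith),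
          if_neg (fun h2 => absurd h2.1 h'.not_ge), if_neg h.not_gt, if_pos h']
        ring
      · rw [max_eq_left h', min_eq_right h, if_pos ⟨h', h⟩]
  · have hi : i ∉ zeroSetStay A b τ x := by simp [zeroSetStay, hx]
    rw [minSubgrad_of_ne_zero hx (sign_face_abs A b τ x (mem_sign_face A b τ x) i)]
    simp [zeroOn, hi, grad]

/-- The call of the second subroutine terminates without increasing the objective; at its output
either the method stops or the zero components dominate. -/
theorem tpcg2_call_spec (hA : A.PosSemidef) (hτ : 0 ≤ τ) (hopt : ∃ xs, IsOptimal A b τ xs)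
    (hε : 0 ≤ ε) (hx : ε < ‖minSubgrad A b τ x‖) :
    ∃ y ∈ tpcg2 A b (signCost A b τ x) (zeroSetStay A b τ x) (negSet x ∪ zeroSetNeg A b τ x)
        (posSet x ∪ zeroSetPos A b τ x) x (ε / max √(n * η) 1),
      objective A b τ y ≤ objective A b τ x ∧
      (‖minSubgrad A b τ y‖ ≤ ε ∨
        √η * normOn (nonzeroSet y) (minSubgrad A b τ y) <
          normOn (zeroSet y) (minSubgrad A b τ y)) := by
  have hmax : 1 ≤ max √(n * η) 1 := le_max_right _ _
  have hε' : 0 ≤ ε / max √(n * η) 1 := by positivity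
  have hεle : ε / max √(n * η) 1 ≤ ε := div_le_self hε hmax
  obtain ⟨xs, hxs⟩ := hopt
  have heq : ∀ y ∈ face (zeroSetStay A b τ x) (negSet x ∪ zeroSetNeg A b τ x)
      (posSet x ∪ zeroSetPos A b τ x),
      objective A b τ y = smoothPart A (b - signCost A b τ x) y := fun y hy =>
    objective_eq_smoothPart (sign_face_abs A b τ x hy)
  obtain ⟨y, hy, hyf, hyle, hyn⟩ := tpcg2_spec hA
    ⟨objective A b τ xs, fun y hy => (hxs y).trans_eq (heq y hy)⟩ hε' (mem_sign_face A b τ x)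
    (by rw [zeroOn_grad_eq_minSubgrad A b hτ]; exact hεle.trans_lt hx)
  refine ⟨y, hy, by rwa [heq y hyf, heq x (mem_sign_face A b τ x)], ?_⟩
  rw [or_iff_not_imp_left]
  intro hbig
  have hnz : ∀ i ∈ nonzeroSet y, |minSubgrad A b τ y i| ≤ ε / max √(n * η) 1 := by
    intro i hi
    have hi' : y i ≠ 0 := by simpa [nonzeroSet] using hi
    have hi0 : i ∉ zeroSet y := by simpa [zeroSet] using hi'
    refine le_trans (le_of_eq ?_) ((norm_le_pi_norm _ i).trans hyn)
    rw [minSubgrad_of_ne_zero hi' (sign_face_abs A b τ x hyf i), Real.norm_eq_abs]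
    simp only [zeroOn, hi0, if_false, grad, Pi.sub_apply, Pi.add_apply]
    congr 1; ring
  -- The reduced tolerance is chosen for this estimate: at most `n` components give `√η √n · ε /
  -- max(√(nη), 1) ≤ ε`.
  have hsmall : √η * normOn (nonzeroSet y) (minSubgrad A b τ y) ≤ ε := by
    have h1 : normOn (nonzeroSet y) (minSubgrad A b τ y) ≤ √n * (ε / max √(n * η) 1) := by
      rw [normOn, Real.sqrt_le_left (by positivity), mul_pow, Real.sq_sqrt (by positivity)]
      calc ∑ i ∈ nonzeroSet y, minSubgrad A b τ y i ^ 2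
          ≤ ∑ i ∈ nonzeroSet y, (ε / max √(n * η) 1) ^ 2 :=
            Finset.sum_le_sum fun i hi => by
              rw [← sq_abs]; exact pow_le_pow_left₀ (abs_nonneg _) (hnz i hi) 2
        _ = (nonzeroSet y).card * (ε / max √(n * η) 1) ^ 2 := by simp
        _ ≤ n * (ε / max √(n * η) 1) ^ 2 := by
            gcongr
            simpa using (nonzeroSet y).card_le_univ
    calc √η * normOn (nonzeroSet y) (minSubgrad A b τ y)
        ≤ √η * (√n * (ε / max √(n * η) 1)) := by gcongr
      _ = √(n * η) * (ε / max √(n * η) 1) := by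
          rw [Real.sqrt_mul (by positivity)]; ring
      _ ≤ max √(n * η) 1 * (ε / max √(n * η) 1) := by gcongr; exact le_max_left _ _
      _ = ε := by field_simp
  refine hsmall.trans_lt ?_
  have hex : ∃ i, ε < |minSubgrad A b τ y i| := by
    by_contra! hall
    exact hbig ((pi_norm_le_iff_of_nonneg hε).2 hall)
  obtain ⟨i, hi⟩ := hex
  have hi0 : i ∈ zeroSet y := by
    by_contra hne
    have : i ∈ nonzeroSet y := by simpa [nonzeroSet, zeroSet] using hne
    exact absurd ((hnz i this).trans hεle) hi.not_ge
  refine hi.trans_le (Real.le_sqrt_of_sq_le ?_)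
  rw [sq_abs]
  exact Finset.single_le_sum (f := fun i => minSubgrad A b τ y i ^ 2)
    (fun _ _ => sq_nonneg _) hi0

end L1QP

namespace L1QP

variable {n : ℕ} {A : Matrix (Fin n) (Fin n) ℝ} {b c x x₀ : Fin n → ℝ}
  {τ ε η η₀ ηs ρ : ℝ}

/-! ### Counting the iterations of the main method -/

theorem one_le_guessBound (ηs η₀ ρ : ℝ) : 1 ≤ guessBound ηs η₀ ρ := by
  unfold guessBound
  split_ifs
  · exact le_rfl
  · exact le_max_right _ _

/-- A guess still below `η*` has `j` strictly below the real quotient, hence below its ceiling; the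
`+ 1` in `guessBound` supplies the second unit, leaving room for one more increase. -/
theorem le_guessBound (hη₀ : 0 < η₀) (hρ : 1 < ρ) {j : ℕ} (h : η₀ * ρ ^ j < ηs) :
    (j : ℤ) + 2 ≤ guessBound ηs η₀ ρ := by
  have hpos : 0 < η₀ * ρ ^ j := by positivity
  have hlog := Real.log_lt_log hpos h
  rw [Real.log_mul hη₀.ne' (by positivity), Real.log_pow] at hlog
  have hlt : (j : ℝ) < (Real.log ηs - Real.log η₀) / Real.log ρ := by
    rw [lt_div_iff₀ (Real.log_pos hρ)]; linarith
  have hceil : (j : ℤ) < ⌈(Real.log ηs - Real.log η₀) / Real.log ρ⌉ :=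
    Int.lt_ceil.2 (by simpa using hlt)
  rw [guessBound, if_neg (hpos.trans h).ne']
  exact le_trans (by omega) (le_max_left _ _)

theorem ErrorBound.mono {η' : ℝ} (h : ErrorBound A b τ x₀ η) (hle : η ≤ η') :
    ErrorBound A b τ x₀ η' :=
  ⟨h.1.trans hle, fun x hx => (h.2 x hx).trans (by gcongr)⟩

/-- The invariant of the main method: `j` counts the increases of the guess, `u` whether a
projected subgradient step has been made at `0`, and `e` whether the point was produced by the
second subroutine. -/
def MainInvariant (A : Matrix (Fin n) (Fin n) ℝ) (b : Fin n → ℝ) (τ : ℝ) (x₀ : Fin n → ℝ)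
    (η₀ ρ ε ηs : ℝ) (s : MainState n) : Prop :=
  ∃ j u e : ℕ, s.η = η₀ * ρ ^ j ∧ (j : ℤ) + 1 ≤ guessBound ηs η₀ ρ ∧
    objective A b τ s.x ≤ objective A b τ x₀ ∧
    (∀ I ∈ s.C, I.Nonempty ∧ (ErrorBound A b τ x₀ s.η →
      ∀ y, (∀ i ∈ I, y i = 0) → objective A b τ s.x < objective A b τ y)) ∧
    (u = 0 ∨ u = 1 ∧ objective A b τ s.x < objective A b τ 0) ∧
    (e = 0 ∨ e = 1 ∧ (‖minSubgrad A b τ s.x‖ ≤ ε ∨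
      √s.η * normOn (nonzeroSet s.x) (minSubgrad A b τ s.x) <
        normOn (zeroSet s.x) (minSubgrad A b τ s.x))) ∧
    -- Each projected step is charged twice, for itself and the subroutine call that may precede it,
    -- and so is each increase of the guess; `e` is a call not yet charged. The full set is charged
    -- to `u`, not to `C`.
    s.k ≤ 2 * ((s.C.erase Finset.univ).card + j * (2 ^ n - 2) + u) + 2 * j + e

theorem card_erase_univ_le (hn : 1 ≤ n) {C : Finset (Finset (Fin n))}
    (hC : ∀ I ∈ C, I.Nonempty) : (C.erase Finset.univ).card ≤ 2 ^ n - 2 := by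
  have : NeZero n := ⟨by omega⟩
  have hsub : C.erase Finset.univ ⊆ (Finset.univ.erase ∅).erase Finset.univ := by
    intro I hI
    rw [Finset.mem_erase] at hI
    simp [hI.1, (hC I hI.2).ne_empty]
  refine (Finset.card_le_card hsub).trans (le_of_eq ?_)
  rw [Finset.card_erase_of_mem, Finset.card_erase_of_mem (Finset.mem_univ _)]
  · simp; omega
  · simp [Finset.univ_nonempty.ne_empty]

theorem MainInvariant.k_le (hn : 1 ≤ n) {s : MainState n}
    (h : MainInvariant A b τ x₀ η₀ ρ ε ηs s) :
    (s.k : ℤ) ≤ guessBound ηs η₀ ρ * (2 ^ (n + 1) - 1) := by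
  obtain ⟨j, u, e, -, hj, -, hC, hu, he, hk⟩ := h
  have hcard := card_erase_univ_le hn fun I hI => (hC I hI).1
  have hpow : 2 ≤ 2 ^ n := by simpa using Nat.pow_le_pow_right (n := 2) (by norm_num) hn
  obtain ⟨D, hD⟩ := Nat.exists_eq_add_of_le hpow
  rw [hD, Nat.add_sub_cancel_left] at hcard hk
  have hu' : u ≤ 1 := by rcases hu with h | h <;> omega
  have he' : e ≤ 1 := by rcases he with h | h <;> omega
  have hk' : (s.k : ℤ) ≤ 2 * (D + j * D + 1) + 2 * j + 1 := by
    have : s.k ≤ 2 * (D + j * D + 1) + 2 * j + 1 := by omega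
    exact_mod_cast this
  have hD' : (2 : ℤ) ^ (n + 1) - 1 = 2 * D + 3 := by
    have : (2 : ℤ) ^ n = 2 + D := by exact_mod_cast hD
    rw [pow_succ, this]; ring
  rw [hD']
  -- With `D = 2^n - 2`, the count is at most `2(j+1)D + 2j + 3`, which is at most `(j+1)(2D+3)`.
  have hmul := mul_le_mul_of_nonneg_right hj (by positivity : (0 : ℤ) ≤ 2 * D + 3)
  nlinarith

theorem nonempty_of_normOn_pos {J : Finset (Fin n)} {v : Fin n → ℝ} (h : 0 < normOn J v) :
    J.Nonempty := by
  rw [Finset.nonempty_iff_ne_empty]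
  rintro rfl
  simp [normOn] at h

/-- One iteration of the main method stops or preserves the invariant. -/
theorem cg2vStep_spec (hA : A.PosSemidef) (hτ : 0 ≤ τ) (hopt : ∃ xs, IsOptimal A b τ xs)
    (hη₀ : 0 < η₀) (hρ : 1 < ρ) (hε : 0 ≤ ε) (hηs : ErrorBound A b τ x₀ ηs) (hn : 1 ≤ n)
    {s : MainState n} (h : MainInvariant A b τ x₀ η₀ ρ ε ηs s) :
    (Sum.inl (s.x, s.k) ∈ cg2vStep A b τ ρ ε s ∧ ‖minSubgrad A b τ s.x‖ ≤ ε) ∨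
    ∃ s', Sum.inr s' ∈ cg2vStep A b τ ρ ε s ∧ s'.k = s.k + 1 ∧
      MainInvariant A b τ x₀ η₀ ρ ε ηs s' := by
  obtain ⟨j, u, e, hη, hj, hF, hC, hu, he, hk⟩ := h
  have hηpos : 0 < s.η := by rw [hη]; positivity
  unfold cg2vStep
  by_cases hsmall_grad : ‖minSubgrad A b τ s.x‖ ≤ ε
  · left
    simp only [hsmall_grad, if_true]
    exact ⟨Part.mem_some _, trivial⟩
  right
  simp only [hsmall_grad, if_false]
  by_cases hineq : √s.η * normOn (nonzeroSet s.x) (minSubgrad A b τ s.x) <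
      normOn (zeroSet s.x) (minSubgrad A b τ s.x)
  · simp only [hineq, if_true]
    have he1 : e ≤ 1 := by rcases he with h | h <;> omega
    have hzpos : 0 < normOn (zeroSet s.x) (minSubgrad A b τ s.x) :=
      lt_of_le_of_lt (mul_nonneg (Real.sqrt_nonneg _) (normOn_nonneg _ _)) hineq
    by_cases hmem : s.C ≠ ∅ ∧ ∃ I ∈ s.C, I ⊆ zeroSet s.x
    · rw [if_pos hmem]
      obtain ⟨I, hI, hsub⟩ := hmem.2
      -- The current point vanishes on `I`, so a valid guess would give `F(x) < F(x)`.
      have hnot : ¬ErrorBound A b τ x₀ s.η := fun hE =>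
        lt_irrefl _ ((hC I hI).2 hE s.x fun i hi => by simpa [zeroSet] using hsub hi)
      have hlt : η₀ * ρ ^ j < ηs := by
        rw [← hη]
        by_contra! hle
        exact hnot (hηs.mono hle)
      refine ⟨_, Part.mem_some _, rfl, j + 1, u, 0, ?_, ?_, hF, by simp, hu, Or.inl rfl, ?_⟩
      · simp only [hη]; ring
      · have := le_guessBound hη₀ hρ hlt
        push_cast; omega
      · have hcard := card_erase_univ_le hn fun I hI => (hC I hI).1
        simp only [Finset.erase_empty, Finset.card_empty, add_mul, one_mul]
        omega
    · rw [if_neg hmem]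
      have hnew : ∀ I ∈ s.C, ¬I ⊆ zeroSet s.x := fun I hI hsub =>
        hmem ⟨Finset.ne_empty_of_mem hI, I, hI, hsub⟩
      have hpp := projSubgrad_dot_self A b τ s.x
      have hv : 0 < projSubgrad A b τ s.x ⬝ᵥ projSubgrad A b τ s.x := by rw [hpp]; positivity
      have hd := projSubgrad_curvature_pos hA hτ hopt hv
      obtain ⟨hdec, hquant⟩ := objective_projSubgrad_step hA hτ hopt hv rfl
      simp only [partDiv, hd.ne', if_false, Part.bind_some]
      set x' := s.x - (projSubgrad A b τ s.x ⬝ᵥ projSubgrad A b τ s.x /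
        (projSubgrad A b τ s.x ⬝ᵥ (A *ᵥ projSubgrad A b τ s.x))) • projSubgrad A b τ s.x
      have hI : ∀ I ∈ insert (zeroSet s.x) s.C, I.Nonempty ∧ (ErrorBound A b τ x₀ s.η →
          ∀ y, (∀ i ∈ I, y i = 0) → objective A b τ x' < objective A b τ y) := by
        intro I hI
        rcases Finset.mem_insert.1 hI with rfl | hI
        · refine ⟨nonempty_of_normOn_pos hzpos, fun hE y hy => ?_⟩
          refine lt_of_lt_of_le ?_ (faceMin_le hopt hy)
          have h1 := hE.2 s.x hF
          have h2 : s.η * normOn (nonzeroSet s.x) (minSubgrad A b τ s.x) ^ 2 <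
              normOn (zeroSet s.x) (minSubgrad A b τ s.x) ^ 2 := by
            have := pow_lt_pow_left₀ hineq
              (mul_nonneg (Real.sqrt_nonneg _) (normOn_nonneg _ _)) two_ne_zero
            rwa [mul_pow, Real.sq_sqrt hηpos.le] at this
          rw [hpp] at hquant
          -- The gap to `F*_x`, times `2‖A‖`, is strictly below `‖v^P‖²`, hence below `2‖A‖` times
          -- the actual decrease. Cancelling a nonnegative factor from a strict inequality also
          -- covers `A = 0`.
          have h3 := (h1.trans_lt h2).trans_le hquant
          have h4 := lt_of_mul_lt_mul_left h3 (mul_nonneg zero_le_two (specNorm_nonneg A))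
          linarith
        · exact ⟨(hC I hI).1, fun hE y hy => hdec.trans ((hC I hI).2 hE y hy)⟩
      by_cases huniv : zeroSet s.x = Finset.univ
      · have hx0 : s.x = 0 := by
          ext i
          have : i ∈ zeroSet s.x := by rw [huniv]; exact Finset.mem_univ i
          simpa [zeroSet] using this
        -- An earlier projected step at the origin would have left `F` strictly below `F(0)` ever
        -- since.
        have hu0 : u = 0 := by
          rcases hu with h | ⟨-, h⟩
          · exact h
          · exact absurd (by rw [hx0]) h.ne
        refine ⟨_, Part.mem_some _, rfl, j, 1, 0, hη, hj, hdec.le.trans hF, hI,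
          Or.inr ⟨rfl, by rw [← hx0]; exact hdec⟩, Or.inl rfl, ?_⟩
        simp only [huniv, Finset.erase_insert_eq_erase]
        omega
      · refine ⟨_, Part.mem_some _, rfl, j, u, 0, hη, hj, hdec.le.trans hF, hI,
          hu.imp_right fun h => ⟨h.1, hdec.trans h.2⟩, Or.inl rfl, ?_⟩
        have hnm : zeroSet s.x ∉ s.C.erase Finset.univ := fun h =>
          hnew _ (Finset.mem_of_mem_erase h) subset_rfl
        simp only [Finset.erase_insert_of_ne huniv, Finset.card_insert_of_notMem hnm]
        omega
  · simp only [hineq, if_false]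
    -- A point produced by the second subroutine either stops the method or satisfies the
    -- inequality, so this branch never follows itself.
    have he0 : e = 0 := by
      rcases he with h | ⟨-, h | h⟩
      · exact h
      · exact absurd h hsmall_grad
      · exact absurd h hineq
    obtain ⟨y, hy, hyF, hend⟩ := tpcg2_call_spec (η := s.η) hA hτ hopt hε (not_le.1 hsmall_grad)
    refine ⟨_, Part.mem_map _ hy, rfl, j, u, 1, hη, hj, hyF.trans hF, fun I hI =>
      ⟨(hC I hI).1, fun hE z hz => hyF.trans_lt ((hC I hI).2 hE z hz)⟩,
      hu.imp_right fun h => ⟨h.1, hyF.trans_lt h.2⟩, Or.inr ⟨rfl, hend⟩, ?_⟩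
    simp only
    omega

/-- The method terminates within the stated number of iterations. -/
theorem cg2v_spec (hA : A.PosSemidef) (hτ : 0 ≤ τ) (hopt : ∃ xs, IsOptimal A b τ xs)
    (hη₀ : 0 < η₀) (hρ : 1 < ρ) (hε : 0 ≤ ε) (hηs : ErrorBound A b τ x₀ ηs) :
    ∃ o ∈ cg2v A b τ x₀ η₀ ρ ε, ‖minSubgrad A b τ o.1‖ ≤ ε ∧
      (o.2 : ℤ) ≤ guessBound ηs η₀ ρ * (2 ^ (n + 1) - 1) := by
  have hB : 0 ≤ guessBound ηs η₀ ρ * (2 ^ (n + 1) - 1) :=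
    mul_nonneg (zero_le_one.trans (one_le_guessBound _ _ _))
      (sub_nonneg.2 (one_le_pow₀ (by norm_num)))
  -- In dimension zero the truncated difference `2^n - 2` is useless for counting, but the method
  -- stops at once.
  rcases Nat.eq_zero_or_pos n with rfl | hn
  · have hsmall_grad : ‖minSubgrad A b τ x₀‖ ≤ ε := by
      rw [Subsingleton.elim (minSubgrad A b τ x₀) 0, norm_zero]; exact hε
    refine ⟨(x₀, 0), PFun.mem_fix_iff.2 (Or.inl ?_), hsmall_grad, hB⟩
    simp only [cg2vStep, hsmall_grad, if_true]
    exact Part.mem_some _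
  · lift guessBound ηs η₀ ρ * (2 ^ (n + 1) - 1) to ℕ using hB with N hN
    let Inv : ℕ → MainState n → Prop := fun m s =>
      MainInvariant A b τ x₀ η₀ ρ ε ηs s ∧ m + s.k = N + 1
    have hinit : Inv (N + 1) ⟨0, η₀, ∅, x₀⟩ :=
      ⟨⟨0, 0, 0, by simp, by simpa using one_le_guessBound ηs η₀ ρ, le_rfl, by simp,
        Or.inl rfl, Or.inl rfl, Nat.zero_le _⟩, rfl⟩
    refine exists_mem_fix ?_ hinit
    rintro m s ⟨hs, hm⟩
    have hk : s.k ≤ N := by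
      have := hs.k_le hn
      rw [← hN] at this
      exact_mod_cast this
    rcases cg2vStep_spec hA hτ hopt hη₀ hρ hε hηs hn hs with ⟨h1, h2⟩ | ⟨s', h1, h2, h3⟩
    · exact Or.inl ⟨_, h1, h2, by exact_mod_cast hk⟩
    · exact Or.inr ⟨s', m - 1, by omega, h1, h3, by omega⟩

end L1QP

theorem mainTheorem3 (n : ℕ) (A : Matrix (Fin n) (Fin n) ℝ) (hA : A.PosSemidef)
    (b : Fin n → ℝ) (τ : ℝ) (hτ : 0 ≤ τ) (hopt : ∃ xs, L1QP.IsOptimal A b τ xs)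
    (x₀ : Fin n → ℝ) (η₀ : ℝ) (hη₀ : 0 < η₀) (ρ : ℝ) (hρ : 1 < ρ) (ε : ℝ) (hε : 0 ≤ ε) :
    ∃ ηs : ℝ, IsLeast {η : ℝ | L1QP.ErrorBound A b τ x₀ η} ηs ∧
      ∃ (y : Fin n → ℝ) (k : ℕ), (y, k) ∈ L1QP.cg2v A b τ x₀ η₀ ρ ε ∧
        (k : ℤ) ≤ L1QP.guessBound ηs η₀ ρ * (2 ^ (n + 1) - 1) ∧
        (∃ s ∈ L1QP.subdifferential (L1QP.objective A b τ) y, ‖s‖ ≤ ε) ∧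
        (ε = 0 → L1QP.IsOptimal A b τ y) := by
  obtain ⟨ηs, hηs⟩ := L1QP.exists_isLeast_errorBound hA hτ hopt x₀
  obtain ⟨⟨y, k⟩, hmem, hv, hk⟩ := L1QP.cg2v_spec hA hτ hopt hη₀ hρ hε hηs.1
  refine ⟨ηs, hηs, y, k, hmem, hk,
    ⟨_, L1QP.minSubgrad_mem_subdifferential hA b hτ y, hv⟩, ?_⟩
  rintro rfl
  exact L1QP.isOptimal_of_minSubgrad_eq_zero hA hτ (norm_le_zero_iff.1 hv)
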